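/- Fix $k>0$. For $\beta\in\mathbb R$, parabolic coordinates $\xi\ge 0$, $\eta\in\mathbb R$ and $x=\frac{\xi^2-\eta^2}{2}$, $y=\xi\eta$, let $$\Psi^{(+)}_{k\beta}(\xi,\eta)=\frac{|\Gamma(\frac14+\frac{i\beta}{2k})|^2}{2\sqrt2\,\pi^2}\,e^{-ik\frac{\xi^2+\eta^2}{2}}\,{}_1F_1\!\left(\tfrac14+\tfrac{i\beta}{2k};\tfrac12;ik\xi^2\right){}_1F_1\!\left(\tfrac14-\tfrac{i\beta}{2k};\tfrac12;ik\eta^2\right),$$ $$\Psi^{(-)}_{k\beta}(\xi,\eta)=\frac{\sqrt2\,k\,|\Gamma(\frac34+\frac{i\beta}{2k})|^2}{\pi^2}\,\xi\eta\,e^{-ik\frac{\xi^2+\eta^2}{2}}\,{}_1F_1\!\left(\tfrac34+\tfrac{i\beta}{2k};\tfrac32;ik\xi^2\right){}_1F_1\!\left(\tfrac34-\tfrac{i\beta}{2k};\tfrac32;ik\eta^2\right)$$ be the parabolic wave functions, let $$\Psi^{(+)}_{k|\alpha|}(x,y)=\frac{\sqrt k}{2\pi}e^{ikx\cos|\alpha|}\cos(ky\sin|\alpha|),\qquad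 \Psi^{(-)}_{k|\alpha|}(x,y)=\frac{\sqrt k}{2\pi}e^{ikx\cos|\alpha|}\sin(ky\sin|\alpha|)$$ be the even and odd Cartesian wave functions, and let $\Psi_{km}(r,\varphi)=\sqrt k\,J_{|m|}(kr)\,e^{im\varphi}/\sqrt{2\pi}$, $m\in\mathbb Z$, be the polar ones. Put $$\mathcal S^{(+)}_{m\alpha}=\frac{(-i)^{|m|}}{\sqrt{2\pi}}\cos m\alpha,\qquad \mathcal S^{(-)}_{m\alpha}=-\operatorname{sign}(\sin\alpha)\frac{(-i)^{|m|}}{\sqrt{2\pi}}\sin m\alpha .$$ Then the following hold. 1. For each sign and each $\beta\in\mathbb R$ there is exactly one family $(\mathcal W^{(\pm)}_{k\beta m})_{m\in\mathbb Z}$ of complex numbers with $\Psi^{(\pm)}_{k\beta}(\xi,\eta)=\sum_{m\in\mathbb Z}\mathcal W^{(\pm)}_{k\beta m}\Psi_{km}(r,\varphi)$ (unconditional convergence) at all points of the plane other than the origin, where $x=r\cos\varphi$, $y=r\sin\varphi$, $r>0$. For $0<|\alpha|<\pi$ the series $\mathcal Z^{(\pm)}_{k\beta|\alpha|}=\sum_{m}\mathcal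 W^{(\pm)}_{k\beta m}\mathcal S^{(\pm)}_{m\alpha}$ converges in the sense of the symmetric partial sums $\sum_{m=-N}^{N}$, $N\to\infty$, and $$\mathcal Z^{(+)}_{k\beta|\alpha|}=\mathcal Z^{(-)}_{k\beta|\alpha|}=\mathcal Z_{k\beta|\alpha|}:=\frac{1}{2\sqrt{\pi k\sin|\alpha|}}\left(\cot\frac{|\alpha|}{2}\right)^{i\beta/k}.$$ 2. For all $\beta,\eta\in\mathbb R$, $\xi\ge0$, $$\Psi^{(\pm)}_{k\beta}(\xi,\eta)=2\int_0^\pi \mathcal Z_{k\beta|\alpha|}\,\Psi^{(\pm)}_{k|\alpha|}(x,y)\,d\alpha ,$$ with an absolutely convergent integral. 3. $\int_{-\infty}^\infty \mathcal Z_{k\beta|\alpha|}\mathcal Z^*_{k\beta|\alpha'|}\,d\beta=\frac12\delta(|\alpha|-|\alpha'|)$ for $0<|\alpha'|<\pi$, as distributions in $\alpha\in(-\pi,\pi)$, where $\delta(|\alpha|-|\alpha'|)=\delta(\alpha-\alpha')+\delta(\alpha+\alpha')$. That is, for every smooth $f:\mathbb R\to\mathbb C$, $$\int_{-\infty}^{\infty}\left(\int_{-\pi}^{\pi}\mathcal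 Z_{k\beta|\alpha|}\mathcal Z^*_{k\beta|\alpha'|}f(\alpha)\,d\alpha\right)d\beta=\tfrac12\bigl(f(\alpha')+f(-\alpha')\bigr),$$ where the inner integral and then the outer integral converge absolutely. 4. $\int_{-\pi}^{\pi}\mathcal Z_{k\beta|\alpha|}\mathcal Z^*_{k\beta'|\alpha|}\,d\alpha=\delta(\beta-\beta')$ for $\beta'\in\mathbb R$, as tempered distributions in $\beta$. That is, for every Schwartz function $f$ on $\mathbb R$, $$\int_{-\pi}^{\pi}\left(\int_{-\infty}^{\infty}\mathcal Z_{k\beta|\alpha|}\mathcal Z^*_{k\beta'|\alpha|}f(\beta)\,d\beta\right)d\alpha=f(\beta'),$$ where the inner integral (for $0<|\alpha|<\pi$) and then the outer integral converge absolutely. 5. For $0<|\alpha|<\pi$, $\xi\ge0$, $\eta\in\mathbb R$, $$\Psi^{(\pm)}_{k|\alpha|}(x,y)=\int_{-\infty}^\infty \mathcal Z^{*}_{k\beta|\alpha|}\,\Psi^{(\pm)}_{k\beta}(\xi,\eta)\,d\beta ,$$ with an absolutely convergent integral. -/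

import Mathlib

open Filter Topology MeasureTheory
open scoped ComplexConjugate SchwartzMap ContDiff

namespace HelmholtzPlane

/-- Parity of a wave function under the reflection `y ↦ -y` (equivalently `η ↦ -η`):
`even` is the superscript `(+)`, `odd` is the superscript `(-)`. -/
inductive WaveParity
  | even
  | odd

/-- Kummer's confluent hypergeometric function
`₁F₁(a; b; z) = ∑ (a)_n / (b)_n * z ^ n / n!`. -/
noncomputable def hyp1F1 (a b z : ℂ) : ℂ :=
  ∑' n : ℕ, (ascPochhammer ℂ n).eval a / (ascPochhammer ℂ n).eval b * z ^ n / (n.factorial : ℂ)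

/-- The Bessel function `J_n` of the first kind, of order `n = 0, 1, 2, …`, at a real point. -/
noncomputable def besselJ (n : ℕ) (t : ℝ) : ℝ :=
  ∑' j : ℕ, (-1 : ℝ) ^ j / ((j.factorial : ℝ) * ((j + n).factorial : ℝ)) * (t / 2) ^ (2 * j + n)

/-- The Cartesian wave functions of definite parity,
`Ψ⁽⁺⁾(x, y) = √k / (2π) * exp (i k x cos|α|) * cos (k y sin|α|)` and the same with `sin` in place
of the last `cos` for `Ψ⁽⁻⁾`. -/
noncomputable def cartesianWave (s : WaveParity) (k α x y : ℝ) : ℂ :=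
  match s with
  | .even => (√k / (2 * Real.pi) : ℝ) * Complex.exp (Complex.I * (k * x * Real.cos |α| : ℝ)) *
      (Real.cos (k * Real.sin |α| * y) : ℝ)
  | .odd => (√k / (2 * Real.pi) : ℝ) * Complex.exp (Complex.I * (k * x * Real.cos |α| : ℝ)) *
      (Real.sin (k * Real.sin |α| * y) : ℝ)

/-- The polar wave functions `√k * J_{|m|}(k r) * exp (i m φ) / √(2π)`. -/
noncomputable def polarWave (k : ℝ) (m : ℤ) (r φ : ℝ) : ℂ :=
  (√k * besselJ m.natAbs (k * r) : ℝ) * Complex.exp (Complex.I * m * φ) /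
    (√(2 * Real.pi) : ℝ)

/-- The normalization constants `C⁽±⁾` of the parabolic wave functions. -/
noncomputable def parabolicConst (s : WaveParity) (k β : ℝ) : ℝ :=
  match s with
  | .even => ‖Complex.Gamma (1 / 4 + Complex.I * β / (2 * k))‖ ^ 2 / (2 * √2 * Real.pi ^ 2)
  | .odd => √2 * k * ‖Complex.Gamma (3 / 4 + Complex.I * β / (2 * k))‖ ^ 2 / Real.pi ^ 2

/-- The parabolic wave functions of definite parity, in the parabolic coordinates
`x = (ξ² - η²) / 2`, `y = ξ η`. -/
noncomputable def parabolicWave (s : WaveParity) (k β ξ η : ℝ) : ℂ :=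
  match s with
  | .even => (parabolicConst .even k β : ℂ) *
      Complex.exp (-Complex.I * k * ((ξ ^ 2 + η ^ 2) / 2)) *
      hyp1F1 (1 / 4 + Complex.I * β / (2 * k)) (1 / 2) (Complex.I * k * ξ ^ 2) *
      hyp1F1 (1 / 4 - Complex.I * β / (2 * k)) (1 / 2) (Complex.I * k * η ^ 2)
  | .odd => (parabolicConst .odd k β : ℂ) * (ξ * η) *
      Complex.exp (-Complex.I * k * ((ξ ^ 2 + η ^ 2) / 2)) *
      hyp1F1 (3 / 4 + Complex.I * β / (2 * k)) (3 / 2) (Complex.I * k * ξ ^ 2) *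
      hyp1F1 (3 / 4 - Complex.I * β / (2 * k)) (3 / 2) (Complex.I * k * η ^ 2)

/-- `W` is the family of coefficients of an expansion, over all `m : ℤ`, of the parabolic wave
function in the polar wave functions with the same `k`; it holds at every point of the plane
other than the origin, in all its polar and parabolic coordinates. -/
def IsParabolicPolarExpansion (s : WaveParity) (k β : ℝ) (W : ℤ → ℂ) : Prop :=
  ∀ ξ η r φ : ℝ, 0 ≤ ξ → 0 < r →
    (ξ ^ 2 - η ^ 2) / 2 = r * Real.cos φ → ξ * η = r * Real.sin φ →
    HasSum (fun m : ℤ => W m * polarWave k m r φ) (parabolicWave s k β ξ η)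

/-- The coefficients `S⁽±⁾` of the expansion of the polar wave functions over the Cartesian ones:
`S⁽⁺⁾ = (-i)^|m| cos (m α) / √(2π)` and `S⁽⁻⁾ = - sign (sin α) (-i)^|m| sin (m α) / √(2π)`. -/
noncomputable def polarCartesianCoeff (s : WaveParity) (m : ℤ) (α : ℝ) : ℂ :=
  match s with
  | .even => (-Complex.I) ^ m.natAbs / (√(2 * Real.pi) : ℝ) * (Real.cos (m * α) : ℝ)
  | .odd => -(Real.sign (Real.sin α) : ℂ) *
      ((-Complex.I) ^ m.natAbs / (√(2 * Real.pi) : ℝ)) * (Real.sin (m * α) : ℝ)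

/-- The closed form `(cot (|α|/2)) ^ (i β / k) / (2 √(π k sin|α|))`, used for `0 < |α| < π`, where
the base of the power is a positive real number. -/
noncomputable def kernelZ (k β α : ℝ) : ℂ :=
  ((Real.cot (|α| / 2) : ℝ) : ℂ) ^ (Complex.I * β / k) /
    (2 * √(Real.pi * k * Real.sin |α|) : ℝ)

end HelmholtzPlane

open HelmholtzPlane

namespace HelmholtzPlane

/-! ### Hypergeometric series -/

/-! Everything rests on two substitutions in the angle.

With x = cos²(α/2) the kernel Z, times a constant, is the beta weight x^(a-1) (1-x)^(a'-1) dx with a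
+ a' = 1/2. An Euler-type formula, `integral_eq_hyp1F1_mul_hyp1F1`, evaluates the integral of such a
weight with a + a' = b against exp(z₁x + z₂(1-x)) ₀F₁(b; z₁z₂x(1-x)) as a constant times ₁F₁(a; b;
z₁) ₁F₁(a'; b; z₂). For z₁ = ikξ² and z₂ = ikη² the exponential gives the plane-wave phase, while
₀F₁ is a cosine for b = 1/2 and a sine up to an elementary factor for b = 3/2. This represents
parabolic waves by Cartesian ones. The formula comes from termwise integration of a triple series,
whose diagonal sums are evaluated by Chu-Vandermonde.

With cot(α/2) = exp u the kernel becomes exp(iβu/k) times √(cosh u), up to a constant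
(`kernelZ_angle`). Integration against Z over (0, π) is then a Fourier transform in u, and both
orthogonality relations and the inverse expansion are Fourier inversion
(`fourier_inversion_scaled`). Inversion needs an integrable transform; for smooth functions of α
this follows from two integrable derivatives in u.

Inserting the Jacobi-Anger expansion into the integral representation gives the polar coefficients W
as cosine or sine coefficients of Z on (0, π). They are unique because J_n(1) ≠ 0 on the circle kr =
1. The sum of W S is then the trigonometric series of Z at |α|; it converges since Z is integrable
and differentiable inside the interval (`tendsto_sum_angularFactor`). -/

theorem ascPochhammer_eval_add (m n : ℕ) (b : ℂ) :
    (ascPochhammer ℂ (m + n)).eval b =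
      (ascPochhammer ℂ m).eval b * (ascPochhammer ℂ n).eval (b + m) := by
  rw [← ascPochhammer_mul]; simp

theorem ascPochhammer_eval_succ_left (n : ℕ) (b : ℂ) :
    (ascPochhammer ℂ (n + 1)).eval b = b * (ascPochhammer ℂ n).eval (b + 1) := by
  rw [ascPochhammer_succ_left]; simp

/-- The Chu-Vandermonde identity for rising factorials. -/
theorem sum_choose_mul_descFactorial_mul_ascPochhammer (m n : ℕ) (b : ℂ) :
    ∑ p ∈ Finset.HasAntidiagonal.antidiagonal m, (m.choose p.1 : ℂ) *
      ((n.descFactorial p.1 : ℂ) * (ascPochhammer ℂ p.2).eval (b + p.1)) =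
    (ascPochhammer ℂ m).eval (b + n) := by
  induction m generalizing b with
  | zero => simp
  | succ m ih =>
    -- Pascal's rule splits the sum in two. The matching terms carry the factors b + i and n - i,
    -- which add up to b + n, so the induction hypothesis is wanted at b + 1.
    have h := Finset.sum_antidiagonal_choose_succ_mul (R := ℂ)
      (fun i j => (n.descFactorial i : ℂ) * (ascPochhammer ℂ j).eval (b + i)) m
    rw [h, ascPochhammer_eval_succ_left, add_right_comm, ← ih, ← Finset.sum_add_distrib,
      Finset.mul_sum]
    refine Finset.sum_congr rfl fun p hp => ?_
    have hs : m.choose p.2 = m.choose p.1 := by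
      rw [Finset.HasAntidiagonal.mem_antidiagonal] at hp
      exact (Nat.choose_symm_of_eq_add (by omega)).symm
    rw [hs, ascPochhammer_eval_succ_left, Nat.descFactorial_succ]
    have hd : (((n - p.1) * n.descFactorial p.1 : ℕ) : ℂ) =
        ((n : ℂ) - p.1) * n.descFactorial p.1 := by
      rcases le_or_gt p.1 n with h | h
      · push_cast [Nat.cast_sub h]; ring
      · simp [Nat.descFactorial_eq_zero_iff_lt.2 h]
    rw [hd]
    push_cast
    rw [show b + ((p.1 : ℂ) + 1) = b + p.1 + 1 by ring,
      show b + 1 + (p.1 : ℂ) = b + p.1 + 1 by ring]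
    ring

theorem ascPochhammer_eval_ne_zero {b : ℝ} (hb : 0 < b) (n : ℕ) :
    (ascPochhammer ℂ n).eval (b : ℂ) ≠ 0 := by
  induction n with
  | zero => simp
  | succ n ih =>
    rw [ascPochhammer_succ_eval]
    refine mul_ne_zero ih ?_
    have : (0 : ℝ) < b + n := by positivity
    exact_mod_cast this.ne'

/-- Every factor b + i is at least 1/2. This lets an exponential series in 2‖z‖ dominate ₀F₁. -/
theorem norm_inv_ascPochhammer_le {b : ℝ} (hb : 1 / 2 ≤ b) (n : ℕ) :
    ‖((ascPochhammer ℂ n).eval (b : ℂ))⁻¹‖ ≤ 2 ^ n := by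
  induction n with
  | zero => simp
  | succ n ih =>
    rw [ascPochhammer_succ_eval, mul_inv, norm_mul, pow_succ]
    refine mul_le_mul ih ?_ (norm_nonneg _) (by positivity)
    rw [norm_inv, show (b : ℂ) + n = ((b + n : ℝ) : ℂ) by push_cast; rfl, Complex.norm_real,
      Real.norm_of_nonneg (by positivity)]
    refine inv_le_of_inv_le₀ (by norm_num) ?_
    have : (0 : ℝ) ≤ n := n.cast_nonneg
    linarith

theorem Gamma_add_nat {z : ℂ} (hz : 0 < z.re) (n : ℕ) :
    Complex.Gamma (z + n) = (ascPochhammer ℂ n).eval z * Complex.Gamma z := by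
  induction n with
  | zero => simp
  | succ n ih =>
    have h0 : z + n ≠ 0 := fun h => by
      have := congrArg Complex.re h
      simp at this
      have h2 : (0 : ℝ) ≤ n := n.cast_nonneg
      linarith
    rw [ascPochhammer_succ_eval, Nat.cast_succ, ← add_assoc, Complex.Gamma_add_one _ h0, ih]
    ring

/-- The shifted Gamma values produce the numerators of both Kummer series; the denominator (b)_(m+n)
is the factor that the diagonal sum later cancels. -/
theorem betaIntegral_add_nat {A B : ℂ} {b : ℝ} (hAB : A + B = b) (hA : 0 < A.re) (hB : 0 < B.re)
    (m n : ℕ) :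
    Complex.betaIntegral (A + m) (B + n) =
      Complex.Gamma A * Complex.Gamma B / Complex.Gamma b *
        ((ascPochhammer ℂ m).eval A * (ascPochhammer ℂ n).eval B /
          (ascPochhammer ℂ (m + n)).eval (b : ℂ)) := by
  have hm : (0 : ℝ) ≤ m := m.cast_nonneg
  have hn : (0 : ℝ) ≤ n := n.cast_nonneg
  have hre : 0 < b := by
    have := congrArg Complex.re hAB
    simp at this
    linarith
  have h := Complex.Gamma_mul_Gamma_eq_betaIntegral (s := A + m) (t := B + n)
    (by simp; linarith) (by simp; linarith)
  have e : A + m + (B + n) = (b : ℂ) + ((m + n : ℕ) : ℂ) := by rw [← hAB]; push_cast; ring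
  rw [e, Gamma_add_nat hA, Gamma_add_nat hB, Gamma_add_nat (by simpa using hre)] at h
  have h1 := ascPochhammer_eval_ne_zero hre (m + n)
  have h2 : Complex.Gamma b ≠ 0 := Complex.Gamma_ne_zero_of_re_pos (by simpa using hre)
  field_simp
  linear_combination -h

/-- The diagonal sums of the triple series for the product of two Kummer functions. -/
theorem sum_kummer_diagonal {b : ℝ} (hb : 0 < b) (m n : ℕ) :
    ∑ j ∈ Finset.range (m + 1), ((m.choose j : ℂ) * n.descFactorial j /
      (m.factorial * n.factorial * (ascPochhammer ℂ j).eval (b : ℂ))) =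
    (ascPochhammer ℂ (m + n)).eval (b : ℂ) / ((ascPochhammer ℂ m).eval (b : ℂ) *
      (ascPochhammer ℂ n).eval (b : ℂ) * m.factorial * n.factorial) := by
  have h := sum_choose_mul_descFactorial_mul_ascPochhammer m n b
  rw [Finset.Nat.sum_antidiagonal_eq_sum_range_succ_mk] at h
  rw [add_comm m n, ascPochhammer_eval_add, ← h, Finset.mul_sum, Finset.sum_div]
  refine Finset.sum_congr rfl fun j hj => ?_
  have hj' : j ≤ m := by simpa [Nat.lt_succ_iff] using hj
  have e := ascPochhammer_eval_add j (m - j) (b : ℂ)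
  rw [Nat.add_sub_cancel' hj'] at e
  have h1 := ascPochhammer_eval_ne_zero hb m
  have h2 := ascPochhammer_eval_ne_zero hb n
  have h3 := ascPochhammer_eval_ne_zero hb j
  have h4 : (m.factorial : ℂ) ≠ 0 := by exact_mod_cast m.factorial_ne_zero
  have h5 : (n.factorial : ℂ) ≠ 0 := by exact_mod_cast n.factorial_ne_zero
  have h6 : (ascPochhammer ℂ (m - j)).eval ((b : ℂ) + j) ≠ 0 := by
    intro h0; rw [h0, mul_zero] at e; exact h1 e
  simp only
  rw [e]
  field_simp

/-! ### The Euler-type integral for a product of two Kummer functions -/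

theorem summable_norm_hypergeometric_zero_one {b : ℝ} (hb : 1 / 2 ≤ b) (z : ℂ) :
    Summable fun j : ℕ => ‖z ^ j / (j.factorial * (ascPochhammer ℂ j).eval (b : ℂ))‖ := by
  refine Summable.of_nonneg_of_le (fun _ => norm_nonneg _) (fun j => ?_)
    (Real.summable_pow_div_factorial (2 * ‖z‖))
  rw [div_eq_mul_inv, mul_inv, norm_mul, norm_mul, norm_pow, norm_inv, Complex.norm_natCast,
    mul_pow]
  have := norm_inv_ascPochhammer_le hb j
  calc ‖z‖ ^ j * ((j.factorial : ℝ)⁻¹ * ‖((ascPochhammer ℂ j).eval (b : ℂ))⁻¹‖)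
      ≤ ‖z‖ ^ j * ((j.factorial : ℝ)⁻¹ * 2 ^ j) := by gcongr
    _ = _ := by ring

/-- The coefficients of the triple series of `exp (z₁ x) exp (z₂ (1 - x)) ₀F₁(b; z₁ z₂ x (1 - x))`. -/
noncomputable def tripleTerm (b : ℝ) (z₁ z₂ : ℂ) (x : ℂ) (t : (ℕ × ℕ) × ℕ) : ℂ :=
  ((z₁ * x) ^ t.1.1 / t.1.1.factorial) * ((z₂ * (1 - x)) ^ t.1.2 / t.1.2.factorial) *
    ((z₁ * z₂ * x * (1 - x)) ^ t.2 / (t.2.factorial * (ascPochhammer ℂ t.2).eval (b : ℂ)))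

theorem summable_norm_mul_mul {f g h : ℕ → ℂ} (hf : Summable fun n => ‖f n‖)
    (hg : Summable fun n => ‖g n‖) (hh : Summable fun n => ‖h n‖) :
    Summable fun t : (ℕ × ℕ) × ℕ => ‖f t.1.1 * g t.1.2 * h t.2‖ :=
  Summable.mul_norm (f := fun p : ℕ × ℕ => f p.1 * g p.2) (Summable.mul_norm hf hg) hh

theorem hasSum_mul_mul {f g h : ℕ → ℂ} {a b c : ℂ} (hf : Summable fun n => ‖f n‖)
    (hg : Summable fun n => ‖g n‖) (hh : Summable fun n => ‖h n‖)
    (ha : HasSum f a) (hb : HasSum g b) (hc : HasSum h c) :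
    HasSum (fun t : (ℕ × ℕ) × ℕ => f t.1.1 * g t.1.2 * h t.2) (a * b * c) :=
  HasSum.mul (f := fun p : ℕ × ℕ => f p.1 * g p.2)
    (HasSum.mul ha hb (summable_mul_of_summable_norm hf hg)) hc (summable_norm_mul_mul hf hg hh).of_norm

theorem summable_norm_pow_div_factorial (w : ℂ) :
    Summable fun n : ℕ => ‖w ^ n / (n.factorial : ℂ)‖ := by
  simpa using Real.summable_pow_div_factorial ‖w‖

theorem hasSum_exp_pow_div_factorial (w : ℂ) :
    HasSum (fun n : ℕ => w ^ n / (n.factorial : ℂ)) (Complex.exp w) := by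
  rw [Complex.exp_eq_exp_ℂ]; exact NormedSpace.expSeries_div_hasSum_exp w

theorem summable_norm_triple {b : ℝ} (hb : 1 / 2 ≤ b) (w₁ w₂ w₃ : ℂ) :
    Summable fun t : (ℕ × ℕ) × ℕ => ‖(w₁ ^ t.1.1 / t.1.1.factorial) *
      (w₂ ^ t.1.2 / t.1.2.factorial) *
      (w₃ ^ t.2 / (t.2.factorial * (ascPochhammer ℂ t.2).eval (b : ℂ)))‖ :=
  summable_norm_mul_mul (f := fun n => w₁ ^ n / n.factorial) (g := fun n => w₂ ^ n / n.factorial)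
    (h := fun n => w₃ ^ n / (n.factorial * (ascPochhammer ℂ n).eval (b : ℂ)))
    (summable_norm_pow_div_factorial w₁) (summable_norm_pow_div_factorial w₂)
    (summable_norm_hypergeometric_zero_one hb w₃)

theorem hasSum_tripleTerm {b : ℝ} (hb : 1 / 2 ≤ b) {z₁ z₂ x F : ℂ}
    (hF : HasSum (fun j : ℕ => (z₁ * z₂ * x * (1 - x)) ^ j /
      (j.factorial * (ascPochhammer ℂ j).eval (b : ℂ))) F) :
    HasSum (tripleTerm b z₁ z₂ x) (Complex.exp (z₁ * x) * Complex.exp (z₂ * (1 - x)) * F) :=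
  hasSum_mul_mul (f := fun n => (z₁ * x) ^ n / n.factorial)
    (g := fun n => (z₂ * (1 - x)) ^ n / n.factorial)
    (h := fun j => (z₁ * z₂ * x * (1 - x)) ^ j / (j.factorial * (ascPochhammer ℂ j).eval (b : ℂ)))
    (summable_norm_pow_div_factorial _) (summable_norm_pow_div_factorial _)
    (summable_norm_hypergeometric_zero_one hb _) (hasSum_exp_pow_div_factorial _)
    (hasSum_exp_pow_div_factorial _) hF

theorem norm_tripleTerm_le (b : ℝ) (z₁ z₂ : ℂ) {x : ℝ} (hx : x ∈ Set.Icc (0 : ℝ) 1)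
    (t : (ℕ × ℕ) × ℕ) :
    ‖tripleTerm b z₁ z₂ x t‖ ≤ ‖(z₁ ^ t.1.1 / t.1.1.factorial) *
      (z₂ ^ t.1.2 / t.1.2.factorial) *
      ((z₁ * z₂) ^ t.2 / (t.2.factorial * (ascPochhammer ℂ t.2).eval (b : ℂ)))‖ := by
  have h1 : ‖(x : ℂ)‖ ≤ 1 := by
    rw [Complex.norm_real, Real.norm_of_nonneg hx.1]; exact hx.2
  have h2 : ‖(1 - x : ℂ)‖ ≤ 1 := by
    rw [← Complex.ofReal_one, ← Complex.ofReal_sub, Complex.norm_real,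
      Real.norm_of_nonneg (by linarith [hx.2])]
    linarith [hx.1]
  unfold tripleTerm
  simp only [norm_mul, norm_div, norm_pow]
  have e1 : ‖z₁‖ * ‖(x : ℂ)‖ ≤ ‖z₁‖ := mul_le_of_le_one_right (norm_nonneg _) h1
  have e2 : ‖z₂‖ * ‖(1 - x : ℂ)‖ ≤ ‖z₂‖ := mul_le_of_le_one_right (norm_nonneg _) h2
  have e3 : ‖z₁‖ * ‖z₂‖ * ‖(x : ℂ)‖ * ‖(1 - x : ℂ)‖ ≤ ‖z₁‖ * ‖z₂‖ :=
    (mul_le_of_le_one_right (by positivity) h2).trans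
      (mul_le_of_le_one_right (by positivity) h1)
  gcongr

theorem continuous_tripleTerm (b : ℝ) (z₁ z₂ : ℂ) (t : (ℕ × ℕ) × ℕ) :
    Continuous fun x : ℝ => tripleTerm b z₁ z₂ x t := by
  unfold tripleTerm; fun_prop

/-- The triple series, rearranged so that the powers of `z₁` and `z₂` are `t.1.1` and `t.1.2`. -/
noncomputable def diagonalTerm (A B : ℂ) (b : ℝ) (z₁ z₂ : ℂ) (t : (ℕ × ℕ) × ℕ) : ℂ :=
  z₁ ^ t.1.1 * z₂ ^ t.1.2 * Complex.betaIntegral (A + t.1.1) (B + t.1.2) *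
    ((t.1.1.choose t.2 : ℂ) * t.1.2.descFactorial t.2 /
      (t.1.1.factorial * t.1.2.factorial * (ascPochhammer ℂ t.2).eval (b : ℂ)))

/-- The term (i, l, j) carries x^(i+j) (1-x)^(l+j), which the beta weight integrates to a shifted
beta integral. The factorials regroup into the binomial and falling factorial needed for
Chu-Vandermonde. -/
theorem integral_tripleTerm (A B : ℂ) (b : ℝ) (z₁ z₂ : ℂ) (t : (ℕ × ℕ) × ℕ) :
    ∫ x : ℝ in 0..1, (x : ℂ) ^ (A - 1) * (1 - (x : ℂ)) ^ (B - 1) * tripleTerm b z₁ z₂ x t =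
      diagonalTerm A B b z₁ z₂ ((t.1.1 + t.2, t.1.2 + t.2), t.2) := by
  obtain ⟨⟨i, l⟩, j⟩ := t
  simp only [diagonalTerm, Complex.betaIntegral]
  rw [mul_assoc, mul_comm (∫ x : ℝ in 0..1, _), ← mul_assoc, ← intervalIntegral.integral_const_mul,
    intervalIntegral.integral_of_le zero_le_one, intervalIntegral.integral_of_le zero_le_one,
    integral_Ioc_eq_integral_Ioo, integral_Ioc_eq_integral_Ioo]
  refine setIntegral_congr_fun measurableSet_Ioo fun x hx => ?_
  have hx0 : (x : ℂ) ≠ 0 := by exact_mod_cast hx.1.ne'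
  have hx1 : (1 - x : ℂ) ≠ 0 := by
    have : (1 - x : ℝ) ≠ 0 := by linarith [hx.2]
    exact_mod_cast this
  simp only [tripleTerm]
  rw [show A + ((i + j : ℕ) : ℂ) - 1 = A - 1 + ((i + j : ℕ) : ℂ) by ring,
    show B + ((l + j : ℕ) : ℂ) - 1 = B - 1 + ((l + j : ℕ) : ℂ) by ring,
    Complex.cpow_add _ _ hx0, Complex.cpow_add _ _ hx1, Complex.cpow_natCast, Complex.cpow_natCast]
  have e1 : ((i + j).choose j : ℂ) / (i + j).factorial = 1 / (i.factorial * j.factorial) := by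
    have h := Nat.add_choose_mul_factorial_mul_factorial i j
    have h' : ((i + j).choose j : ℂ) * i.factorial * j.factorial = (i + j).factorial := by
      exact_mod_cast h
    have h4 : (i.factorial : ℂ) ≠ 0 := by exact_mod_cast i.factorial_ne_zero
    have h5 : (j.factorial : ℂ) ≠ 0 := by exact_mod_cast j.factorial_ne_zero
    have h6 : ((i + j).factorial : ℂ) ≠ 0 := by exact_mod_cast (i + j).factorial_ne_zero
    field_simp
    linear_combination h'
  have e2 : ((l + j).descFactorial j : ℂ) / (l + j).factorial = 1 / l.factorial := by
    have h := Nat.factorial_mul_descFactorial (Nat.le_add_left j l)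
    rw [Nat.add_sub_cancel] at h
    have h' : (l.factorial : ℂ) * (l + j).descFactorial j = (l + j).factorial := by
      exact_mod_cast h
    have h4 : (l.factorial : ℂ) ≠ 0 := by exact_mod_cast l.factorial_ne_zero
    have h6 : ((l + j).factorial : ℂ) ≠ 0 := by exact_mod_cast (l + j).factorial_ne_zero
    field_simp
    linear_combination h'
  rw [show ((i + j).choose j : ℂ) * (l + j).descFactorial j /
      ((i + j).factorial * (l + j).factorial * (ascPochhammer ℂ j).eval (b : ℂ)) =
      ((i + j).choose j : ℂ) / (i + j).factorial * ((l + j).descFactorial j / (l + j).factorial) /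
        (ascPochhammer ℂ j).eval (b : ℂ) by ring, e1, e2]
  simp only [mul_pow, pow_add]
  ring

theorem hasSum_diagonalTerm {A B z₁ z₂ : ℂ} {b : ℝ} (hb : 1 / 2 ≤ b)
    (hA : 0 < A.re) (hB : 0 < B.re) {F : ℝ → ℂ}
    (hF : ∀ x : ℝ, HasSum (fun j : ℕ => (z₁ * z₂ * x * (1 - x)) ^ j /
      (j.factorial * (ascPochhammer ℂ j).eval (b : ℂ))) (F x)) :
    HasSum (diagonalTerm A B b z₁ z₂) (∫ x : ℝ in 0..1,
      (x : ℂ) ^ (A - 1) * (1 - (x : ℂ)) ^ (B - 1) *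
        (Complex.exp (z₁ * x) * Complex.exp (z₂ * (1 - x)) * F x)) := by
  have hβ := Complex.betaIntegral_convergent hA hB
  have hs := summable_norm_triple hb z₁ z₂ (z₁ * z₂)
  have key := intervalIntegral.hasSum_integral_of_dominated_convergence (μ := volume)
    (a := (0 : ℝ)) (b := 1)
    (F := fun (t : (ℕ × ℕ) × ℕ) (x : ℝ) =>
      (x : ℂ) ^ (A - 1) * (1 - (x : ℂ)) ^ (B - 1) * tripleTerm b z₁ z₂ x t)
    (f := fun x : ℝ => (x : ℂ) ^ (A - 1) * (1 - (x : ℂ)) ^ (B - 1) *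
        (Complex.exp (z₁ * x) * Complex.exp (z₂ * (1 - x)) * F x))
    (fun t x => ‖(x : ℂ) ^ (A - 1) * (1 - (x : ℂ)) ^ (B - 1)‖ *
      ‖(z₁ ^ t.1.1 / t.1.1.factorial) * (z₂ ^ t.1.2 / t.1.2.factorial) *
      ((z₁ * z₂) ^ t.2 / (t.2.factorial * (ascPochhammer ℂ t.2).eval (b : ℂ)))‖)
    (fun t => ?_) (fun t => ?_) ?_ ?_ ?_
  · simp only [integral_tripleTerm] at key
    have hinj : Function.Injective
        (fun t : (ℕ × ℕ) × ℕ => (((t.1.1 + t.2, t.1.2 + t.2), t.2) : (ℕ × ℕ) × ℕ)) := by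
      rintro ⟨⟨i, l⟩, j⟩ ⟨⟨i', l'⟩, j'⟩ h
      simp only [Prod.mk.injEq] at h ⊢
      omega
    -- Outside the range of the reindexing j exceeds m or n, and there the binomial or the falling
    -- factorial vanishes.
    refine (hinj.hasSum_iff ?_).1 key
    rintro ⟨⟨m, n⟩, j⟩ h
    simp only [diagonalTerm]
    rcases lt_or_ge m j with hm | hm
    · simp [Nat.choose_eq_zero_of_lt hm]
    rcases lt_or_ge n j with hn | hn
    · simp [Nat.descFactorial_eq_zero_iff_lt.2 hn]
    · exact absurd ⟨((m - j, n - j), j), by simp [hm, hn]⟩ h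
  · rw [Set.uIoc_of_le zero_le_one]
    exact hβ.1.aestronglyMeasurable.mul
      (continuous_tripleTerm b z₁ z₂ t).aestronglyMeasurable
  · refine Eventually.of_forall fun x hx => ?_
    rw [Set.uIoc_of_le zero_le_one] at hx
    rw [norm_mul]
    exact mul_le_mul_of_nonneg_left (norm_tripleTerm_le b z₁ z₂ ⟨hx.1.le, hx.2⟩ t) (norm_nonneg _)
  · exact Eventually.of_forall fun x _ => hs.mul_left _
  · simp only [tsum_mul_left]
    exact hβ.norm.mul_const _
  · exact Eventually.of_forall fun x _ => (hasSum_tripleTerm hb (hF x)).mul_left _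

/-- Since u 0 = v 0 = 1, restricting the double series to the axes shows that each factor is
summable, so the Kummer series need no separate convergence proof. -/
theorem HasSum.eq_mul_tsum_mul_tsum {u v : ℕ → ℂ} {C I : ℂ} (hC : C ≠ 0) (hu : u 0 = 1)
    (hv : v 0 = 1) (h : HasSum (fun p : ℕ × ℕ => C * (u p.1 * v p.2)) I) :
    I = C * ((∑' n, u n) * ∑' n, v n) := by
  have hs : Summable fun p : ℕ × ℕ => u p.1 * v p.2 := (summable_mul_left_iff hC).1 h.summable
  have hu0 : Summable u := by
    have := hs.comp_injective (i := fun m : ℕ => (m, 0)) fun a b hab => (Prod.mk.inj hab).1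
    simpa [Function.comp_def, hv] using this
  have hv0 : Summable v := by
    have := hs.comp_injective (i := fun m : ℕ => (0, m)) fun a b hab => (Prod.mk.inj hab).2
    simpa [Function.comp_def, hu] using this
  rw [← h.tsum_eq, tsum_mul_left, ← tsum_mul_tsum_of_summable_norm hu0.norm hv0.norm]

/-- The sum over j stops at m, and `sum_kummer_diagonal` evaluates it with (b)_(m+n) on top. This
cancels the beta denominator and separates m from n. -/
theorem hasSum_diagonalTerm_fiber {A B z₁ z₂ : ℂ} {b : ℝ} (hb0 : 0 < b) (hAB : A + B = b)
    (hA : 0 < A.re) (hB : 0 < B.re) (m n : ℕ) :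
    HasSum (fun j => diagonalTerm A B b z₁ z₂ ((m, n), j))
      (Complex.Gamma A * Complex.Gamma B / Complex.Gamma b *
        ((ascPochhammer ℂ m).eval A / (ascPochhammer ℂ m).eval (b : ℂ) * z₁ ^ m / m.factorial *
          ((ascPochhammer ℂ n).eval B / (ascPochhammer ℂ n).eval (b : ℂ) * z₂ ^ n /
            n.factorial))) := by
  have h0 := hasSum_sum_of_ne_finset_zero
    (f := fun j => diagonalTerm A B b z₁ z₂ ((m, n), j)) (s := Finset.range (m + 1))
    (L := .unconditional ℕ) (fun j hj => by
      simp [diagonalTerm, Nat.choose_eq_zero_of_lt (show m < j by simpa using hj)])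
  have h1 := ascPochhammer_eval_ne_zero hb0 (m + n)
  have alg (Z₁ Z₂ C a c p d e f g : ℂ) (hp : p ≠ 0) :
      Z₁ * Z₂ * (C * (a * c / p)) * (p / (d * e * f * g)) =
        C * (a / d * Z₁ / f * (c / e * Z₂ / g)) := by
    field_simp
  simp only [diagonalTerm] at h0 ⊢
  rw [betaIntegral_add_nat hAB hA hB] at h0 ⊢
  rw [← Finset.mul_sum, sum_kummer_diagonal hb0, alg _ _ _ _ _ _ _ _ _ _ h1] at h0
  exact h0

/-- An Euler-type integral for the product of two Kummer functions with the same second parameter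
`b` and first parameters adding up to `b`. -/
theorem integral_eq_hyp1F1_mul_hyp1F1 {A B z₁ z₂ : ℂ} {b : ℝ} (hb : 1 / 2 ≤ b)
    (hAB : A + B = b) (hA : 0 < A.re) (hB : 0 < B.re) {F : ℝ → ℂ}
    (hF : ∀ x : ℝ, HasSum (fun j : ℕ => (z₁ * z₂ * x * (1 - x)) ^ j /
      (j.factorial * (ascPochhammer ℂ j).eval (b : ℂ))) (F x)) :
    ∫ x : ℝ in 0..1, (x : ℂ) ^ (A - 1) * (1 - (x : ℂ)) ^ (B - 1) *
        (Complex.exp (z₁ * x) * Complex.exp (z₂ * (1 - x)) * F x) =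
      Complex.Gamma A * Complex.Gamma B / Complex.Gamma b *
        (hyp1F1 A b z₁ * hyp1F1 B b z₂) := by
  have hb0 : 0 < b := by linarith
  have hC0 : Complex.Gamma A * Complex.Gamma B / Complex.Gamma b ≠ 0 :=
    div_ne_zero (mul_ne_zero (Complex.Gamma_ne_zero_of_re_pos hA)
    (Complex.Gamma_ne_zero_of_re_pos hB)) (Complex.Gamma_ne_zero_of_re_pos (by simpa using hb0))
  exact HasSum.eq_mul_tsum_mul_tsum
    (u := fun n => (ascPochhammer ℂ n).eval A / (ascPochhammer ℂ n).eval (b : ℂ) *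
      z₁ ^ n / (n.factorial : ℂ))
    (v := fun n => (ascPochhammer ℂ n).eval B / (ascPochhammer ℂ n).eval (b : ℂ) *
      z₂ ^ n / (n.factorial : ℂ)) hC0 (by simp) (by simp)
    ((hasSum_diagonalTerm hb hA hB hF).prod_fiberwise fun p =>
      hasSum_diagonalTerm_fiber hb0 hAB hA hB p.1 p.2)

/-! ### Trigonometric functions as hypergeometric series -/

theorem factorial_two_mul_eq (n : ℕ) : ((2 * n).factorial : ℂ) =
    4 ^ n * (n.factorial * (ascPochhammer ℂ n).eval (1 / 2 : ℂ)) := by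
  induction n with
  | zero => simp
  | succ n ih =>
    rw [show 2 * (n + 1) = 2 * n + 1 + 1 by ring, Nat.factorial_succ, Nat.factorial_succ,
      ascPochhammer_succ_eval, Nat.factorial_succ n]
    push_cast
    rw [ih]; ring

theorem factorial_two_mul_add_one_eq (n : ℕ) : ((2 * n + 1).factorial : ℂ) =
    4 ^ n * (n.factorial * (ascPochhammer ℂ n).eval (3 / 2 : ℂ)) := by
  induction n with
  | zero => simp
  | succ n ih =>
    rw [show 2 * (n + 1) + 1 = 2 * n + 1 + 1 + 1 by ring, Nat.factorial_succ, Nat.factorial_succ,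
      ascPochhammer_succ_eval, Nat.factorial_succ n]
    push_cast
    rw [ih]; ring

theorem hasSum_cos_hypergeometric (s : ℂ) :
    HasSum (fun j : ℕ => (-(s / 2) ^ 2) ^ j /
      (j.factorial * (ascPochhammer ℂ j).eval ((1 / 2 : ℝ) : ℂ))) (Complex.cos s) := by
  convert Complex.hasSum_cos s using 2 with j
  rw [factorial_two_mul_eq, neg_pow, div_pow, div_pow, pow_mul]
  push_cast
  field_simp
  norm_num

theorem hasSum_sin_hypergeometric (s : ℂ) :
    HasSum (fun j : ℕ => s * ((-(s / 2) ^ 2) ^ j /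
      (j.factorial * (ascPochhammer ℂ j).eval ((3 / 2 : ℝ) : ℂ)))) (Complex.sin s) := by
  convert Complex.hasSum_sin s using 2 with j
  rw [factorial_two_mul_add_one_eq, neg_pow, div_pow, div_pow, pow_succ s (2 * j), pow_mul]
  push_cast
  field_simp
  norm_num

/-! ### Parabolic waves as integrals of Cartesian waves -/

theorem image_half_one_add_cos :
    (fun α : ℝ => (1 + Real.cos α) / 2) '' Set.Ioo 0 Real.pi = Set.Ioo 0 1 := by
  ext x
  constructor
  · rintro ⟨α, hα, rfl⟩
    have h1 : Real.cos α < 1 := by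
      rw [← Real.cos_zero]
      exact Real.cos_lt_cos_of_nonneg_of_le_pi le_rfl hα.2.le hα.1
    have h2 : -1 < Real.cos α := by
      rw [← Real.cos_pi]
      exact Real.cos_lt_cos_of_nonneg_of_le_pi hα.1.le le_rfl hα.2
    constructor <;> simp only <;> linarith
  · rintro ⟨h0, h1⟩
    refine ⟨Real.arccos (2 * x - 1), ⟨?_, ?_⟩, ?_⟩
    · rw [Real.arccos_pos]; linarith
    · refine lt_of_le_of_ne (Real.arccos_le_pi _) fun h => ?_
      rw [Real.arccos_eq_pi] at h; linarith
    · simp only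
      rw [Real.cos_arccos (by linarith) (by linarith)]; ring

theorem injOn_half_one_add_cos :
    Set.InjOn (fun α : ℝ => (1 + Real.cos α) / 2) (Set.Ioo 0 Real.pi) := fun a ha b hb h =>
  Real.injOn_cos ⟨ha.1.le, ha.2.le⟩ ⟨hb.1.le, hb.2.le⟩ (by simp only at h; linarith)

theorem hasDerivWithinAt_half_one_add_cos (s : Set ℝ) (α : ℝ) :
    HasDerivWithinAt (fun α : ℝ => (1 + Real.cos α) / 2) (-Real.sin α / 2) s α :=
  (((Real.hasDerivAt_cos α).const_add 1).div_const 2).hasDerivWithinAt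

theorem abs_neg_sin_div_two {α : ℝ} (hα : α ∈ Set.Ioo 0 Real.pi) :
    |-Real.sin α / 2| = Real.sin α / 2 := by
  rw [neg_div, abs_neg, abs_of_pos (half_pos (Real.sin_pos_of_mem_Ioo hα))]

theorem integral_comp_half_one_add_cos (g : ℝ → ℂ) :
    ∫ x in (0 : ℝ)..1, g x =
      ∫ α in (0 : ℝ)..Real.pi, ((Real.sin α / 2 : ℝ) : ℂ) * g ((1 + Real.cos α) / 2) := by
  rw [intervalIntegral.integral_of_le zero_le_one, intervalIntegral.integral_of_le Real.pi_pos.le,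
    integral_Ioc_eq_integral_Ioo, integral_Ioc_eq_integral_Ioo, ← image_half_one_add_cos,
    integral_image_eq_integral_abs_deriv_smul measurableSet_Ioo
      (fun α _ => hasDerivWithinAt_half_one_add_cos _ α) injOn_half_one_add_cos]
  refine setIntegral_congr_fun measurableSet_Ioo fun α hα => ?_
  rw [abs_neg_sin_div_two hα, Complex.real_smul]

theorem intervalIntegrable_comp_half_one_add_cos {g : ℝ → ℂ}
    (hg : IntervalIntegrable g volume 0 1) :
    IntervalIntegrable
      (fun α => ((Real.sin α / 2 : ℝ) : ℂ) * g ((1 + Real.cos α) / 2)) volume 0 Real.pi := by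
  rw [intervalIntegrable_iff_integrableOn_Ioo_of_le zero_le_one, ← image_half_one_add_cos,
    integrableOn_image_iff_integrableOn_abs_deriv_smul measurableSet_Ioo
      (fun α _ => hasDerivWithinAt_half_one_add_cos _ α) injOn_half_one_add_cos] at hg
  rw [intervalIntegrable_iff_integrableOn_Ioo_of_le Real.pi_pos.le]
  refine hg.congr_fun (fun α hα => ?_) measurableSet_Ioo
  simp only
  rw [abs_neg_sin_div_two hα, Complex.real_smul]

theorem cos_half_pos {α : ℝ} (hα : α ∈ Set.Ioo 0 Real.pi) : 0 < Real.cos (α / 2) :=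
  Real.cos_pos_of_mem_Ioo ⟨by linarith [hα.1, hα.2], by linarith [hα.2]⟩

theorem sin_half_pos {α : ℝ} (hα : α ∈ Set.Ioo 0 Real.pi) : 0 < Real.sin (α / 2) :=
  Real.sin_pos_of_pos_of_lt_pi (by linarith [hα.1]) (by linarith [hα.1, hα.2])

theorem half_one_add_cos_eq (α : ℝ) : (1 + Real.cos α) / 2 = Real.cos (α / 2) ^ 2 := by
  rw [Real.cos_sq, mul_div_cancel₀ α two_ne_zero]; ring

theorem one_sub_half_one_add_cos_eq (α : ℝ) :
    1 - (1 + Real.cos α) / 2 = Real.sin (α / 2) ^ 2 := by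
  rw [half_one_add_cos_eq, Real.sin_sq]

theorem sin_eq_two_mul_half (α : ℝ) :
    Real.sin α = 2 * (Real.cos (α / 2) * Real.sin (α / 2)) := by
  conv_lhs => rw [← mul_div_cancel₀ α (two_ne_zero (α := ℝ)), Real.sin_two_mul]
  ring

theorem sq_cpow {c : ℝ} (hc : 0 < c) (z : ℂ) :
    (((c ^ 2 : ℝ) : ℂ)) ^ z = Complex.exp (2 * Real.log c * z) := by
  rw [Complex.cpow_def_of_ne_zero (by exact_mod_cast (pow_pos hc 2).ne'),
    ← Complex.ofReal_log (pow_pos hc 2).le, Real.log_pow]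
  push_cast
  rfl

/-- With c = cos(α/2) and s = sin(α/2) the powers give (cs)^(-3/2) (c/s)^(iβ/k); the Jacobian sin α
/ 2 = cs leaves (cs)^(-1/2), which is √2 / √(sin α). -/
theorem beta_weight_eq_kernelZ {k : ℝ} (hk : 0 < k) (β : ℝ) {α : ℝ}
    (hα : α ∈ Set.Ioo 0 Real.pi) :
    ((Real.sin α / 2 : ℝ) : ℂ) *
      ((((1 + Real.cos α) / 2 : ℝ) : ℂ) ^ ((1 / 4 + Complex.I * β / (2 * k)) - 1) *
        (1 - (((1 + Real.cos α) / 2 : ℝ) : ℂ)) ^ ((1 / 4 - Complex.I * β / (2 * k)) - 1)) =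
      (2 * √2 * √(Real.pi * k) : ℝ) * kernelZ k β α := by
  have hc := cos_half_pos hα
  have hs := sin_half_pos hα
  have hk' : (k : ℂ) ≠ 0 := by exact_mod_cast hk.ne'
  rw [show (1 - (((1 + Real.cos α) / 2 : ℝ) : ℂ)) = ((1 - (1 + Real.cos α) / 2 : ℝ) : ℂ) by
    push_cast; rfl, one_sub_half_one_add_cos_eq,
    half_one_add_cos_eq, sq_cpow hc, sq_cpow hs, kernelZ, abs_of_pos hα.1,
    Real.cot_eq_cos_div_sin, Complex.cpow_def_of_ne_zero
      (by exact_mod_cast (div_pos hc hs).ne'), ← Complex.ofReal_log (div_pos hc hs).le,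
    Real.log_div hc.ne' hs.ne', sin_eq_two_mul_half]
  -- Writing both half-angle values as exponentials turns the identity between powers into an
  -- addition of exponents.
  obtain ⟨a, ha⟩ : ∃ a, Real.cos (α / 2) = Real.exp a := ⟨_, (Real.exp_log hc).symm⟩
  obtain ⟨b, hb⟩ : ∃ b, Real.sin (α / 2) = Real.exp b := ⟨_, (Real.exp_log hs).symm⟩
  rw [ha, hb, Real.log_exp, Real.log_exp, ← Real.exp_add]
  have h2 : √(Real.pi * k * (2 * Real.exp (a + b))) =
      √(Real.pi * k) * √2 * Real.exp ((a + b) / 2) := by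
    rw [Real.sqrt_mul (by have := Real.pi_pos; positivity), Real.sqrt_mul (by norm_num : (0 : ℝ) ≤ 2),
      Real.exp_half]; ring
  rw [h2, mul_div_cancel_left₀ _ (two_ne_zero (α := ℝ))]
  have h3 : (√(Real.pi * k) : ℂ) ≠ 0 := by
    exact_mod_cast (Real.sqrt_pos.2 (by positivity)).ne'
  have h4 : (√2 : ℂ) ≠ 0 := by exact_mod_cast (Real.sqrt_pos.2 two_pos).ne'
  have h5 : Complex.exp (((a + b : ℝ) : ℂ)) * (Complex.exp (2 * a * (1 / 4 + Complex.I * β / (2 * k) - 1)) *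
      Complex.exp (2 * b * (1 / 4 - Complex.I * β / (2 * k) - 1))) * Complex.exp (((a + b) / 2 : ℝ) : ℂ) =
      Complex.exp (((a - b : ℝ) : ℂ) * (Complex.I * β / k)) := by
    rw [← Complex.exp_add, ← Complex.exp_add, ← Complex.exp_add]
    congr 1
    push_cast
    field_simp
    ring
  have h6 := Complex.exp_ne_zero (((a + b) / 2 : ℝ) : ℂ)
  rw [← h5]
  simp only [Complex.ofReal_exp, Complex.ofReal_mul, Complex.ofReal_ofNat]
  field_simp

theorem kernelZ_neg (k β α : ℝ) : kernelZ k β (-α) = kernelZ k β α := by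
  simp only [kernelZ, abs_neg]

theorem I_mul_div_re (k β : ℝ) : (Complex.I * β / (2 * k) : ℂ).re = 0 := by
  rw [show (Complex.I * β / (2 * k) : ℂ) = ((β / (2 * k) : ℝ) : ℂ) * Complex.I by
    push_cast; ring, Complex.re_ofReal_mul, Complex.I_re, mul_zero]

/-- The endpoint singularities are those of a convergent beta integral whose parameters have real
part 1/4. -/
theorem intervalIntegrable_kernelZ {k : ℝ} (hk : 0 < k) (β : ℝ) :
    IntervalIntegrable (kernelZ k β) volume 0 Real.pi := by
  have hre := I_mul_div_re k β
  have h := intervalIntegrable_comp_half_one_add_cos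
    (Complex.betaIntegral_convergent (u := 1 / 4 + Complex.I * β / (2 * k))
      (v := 1 / 4 - Complex.I * β / (2 * k)) (by rw [Complex.add_re, hre]; norm_num) (by rw [Complex.sub_re, hre]; norm_num))
  have h2 := h.const_mul (((2 * √2 * √(Real.pi * k) : ℝ) : ℂ)⁻¹)
  rw [intervalIntegrable_iff_integrableOn_Ioo_of_le Real.pi_pos.le] at h2 ⊢
  refine h2.congr_fun (fun α hα => ?_) measurableSet_Ioo
  simp only
  rw [beta_weight_eq_kernelZ hk β hα, inv_mul_cancel_left₀]
  exact_mod_cast (by positivity : (0 : ℝ) < 2 * √2 * √(Real.pi * k)).ne'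

theorem continuous_cartesianWave (s : WaveParity) (k x y : ℝ) :
    Continuous fun α => cartesianWave s k α x y := by
  cases s <;> simp only [cartesianWave] <;> fun_prop

theorem intervalIntegrable_kernelZ_mul_cartesianWave (s : WaveParity) {k : ℝ} (hk : 0 < k)
    (β x y : ℝ) :
    IntervalIntegrable (fun α : ℝ => kernelZ k β α * cartesianWave s k α x y)
      volume 0 Real.pi :=
  (intervalIntegrable_kernelZ hk β).mul_continuousOn (continuous_cartesianWave s k x y).continuousOn

/-- The function `₀F₁(b; z₁ z₂ x (1 - x))`. -/
noncomputable def hyp0F1 (b : ℝ) (z₁ z₂ x : ℂ) : ℂ :=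
  ∑' j : ℕ, (z₁ * z₂ * x * (1 - x)) ^ j / (j.factorial * (ascPochhammer ℂ j).eval (b : ℂ))

theorem hasSum_hyp0F1 {b : ℝ} (hb : 1 / 2 ≤ b) (z₁ z₂ x : ℂ) :
    HasSum (fun j : ℕ => (z₁ * z₂ * x * (1 - x)) ^ j /
      (j.factorial * (ascPochhammer ℂ j).eval (b : ℂ))) (hyp0F1 b z₁ z₂ x) :=
  (summable_norm_hypergeometric_zero_one hb _).of_norm.hasSum

/-- Here x(1-x) = sin²α / 4 and z₁z₂ = -k²ξ²η², so ₀F₁ is evaluated exactly where it becomes a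
cosine or a sine of k y sin α. -/
theorem hyp0F1_arg (k ξ η α : ℝ) :
    (Complex.I * k * ξ ^ 2) * (Complex.I * k * η ^ 2) * (((1 + Real.cos α) / 2 : ℝ) : ℂ) *
      (1 - (((1 + Real.cos α) / 2 : ℝ) : ℂ)) =
      -(((k * Real.sin α * (ξ * η) : ℝ) : ℂ) / 2) ^ 2 := by
  have h : ((Real.sin α : ℝ) : ℂ) ^ 2 + ((Real.cos α : ℝ) : ℂ) ^ 2 = 1 := by
    exact_mod_cast Real.sin_sq_add_cos_sq α
  have hI := Complex.I_sq
  simp only [Complex.ofReal_mul, Complex.ofReal_div, Complex.ofReal_add, Complex.ofReal_one,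
    Complex.ofReal_ofNat]
  generalize ((Real.sin α : ℝ) : ℂ) = S at *
  generalize ((Real.cos α : ℝ) : ℂ) = C at *
  linear_combination ((k : ℂ) ^ 2 * ξ ^ 2 * η ^ 2 * (1 - C ^ 2) / 4) * hI +
    ((k : ℂ) ^ 2 * ξ ^ 2 * η ^ 2 / 4) * h

theorem exp_mul_exp_half_one_add_cos (k ξ η α : ℝ) :
    Complex.exp (-Complex.I * k * ((ξ ^ 2 + η ^ 2) / 2)) *
      (Complex.exp ((Complex.I * k * ξ ^ 2) * (((1 + Real.cos α) / 2 : ℝ) : ℂ)) *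
      Complex.exp ((Complex.I * k * η ^ 2) * (1 - (((1 + Real.cos α) / 2 : ℝ) : ℂ)))) =
    Complex.exp (Complex.I * (k * ((ξ ^ 2 - η ^ 2) / 2) * Real.cos α : ℝ)) := by
  rw [← Complex.exp_add, ← Complex.exp_add]
  congr 1
  push_cast
  ring

theorem norm_Gamma_sq (c k β : ℝ) :
    Complex.Gamma (c + Complex.I * β / (2 * k)) * Complex.Gamma (c - Complex.I * β / (2 * k)) =
      ((‖Complex.Gamma (c + Complex.I * β / (2 * k))‖ ^ 2 : ℝ) : ℂ) := by
  have h : (c - Complex.I * β / (2 * k) : ℂ) = conj (c + Complex.I * β / (2 * k) : ℂ) := by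
    simp [map_div₀, Complex.conj_ofNat, sub_eq_add_neg, neg_div]
  rw [h, Complex.Gamma_conj, Complex.mul_conj, Complex.normSq_eq_norm_sq]

theorem sq_cpow_add_half {c : ℝ} (hc : 0 < c) (z : ℂ) :
    (((c ^ 2 : ℝ) : ℂ)) ^ (z + 1 / 2) = c * (((c ^ 2 : ℝ) : ℂ)) ^ z := by
  rw [Complex.cpow_add _ _ (by exact_mod_cast (pow_pos hc 2).ne'), sq_cpow hc (1 / 2),
    show (2 * Real.log c * (1 / 2) : ℂ) = (Real.log c : ℝ) by ring, ← Complex.ofReal_exp,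
    Real.exp_log hc, mul_comm]

/-- Raising both exponents by 1/2 multiplies the even weight by cos(α/2) sin(α/2). -/
theorem beta_weight_eq_sin_mul_kernelZ {k : ℝ} (hk : 0 < k) (β : ℝ) {α : ℝ}
    (hα : α ∈ Set.Ioo 0 Real.pi) :
    ((Real.sin α / 2 : ℝ) : ℂ) *
      ((((1 + Real.cos α) / 2 : ℝ) : ℂ) ^ ((3 / 4 + Complex.I * β / (2 * k)) - 1) *
        (1 - (((1 + Real.cos α) / 2 : ℝ) : ℂ)) ^ ((3 / 4 - Complex.I * β / (2 * k)) - 1)) =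
      (2 * √2 * √(Real.pi * k) : ℝ) * (((Real.sin α / 2 : ℝ) : ℂ) * kernelZ k β α) := by
  have h := beta_weight_eq_kernelZ hk β hα
  have e : (1 - (((1 + Real.cos α) / 2 : ℝ) : ℂ)) = ((1 - (1 + Real.cos α) / 2 : ℝ) : ℂ) := by
    push_cast; rfl
  rw [mul_left_comm (Complex.ofReal (2 * √2 * √(Real.pi * k))), ← h, e, one_sub_half_one_add_cos_eq, half_one_add_cos_eq,
    show (3 / 4 + Complex.I * β / (2 * k) : ℂ) - 1 =
      ((1 / 4 + Complex.I * β / (2 * k)) - 1) + 1 / 2 by ring,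
    show (3 / 4 - Complex.I * β / (2 * k) : ℂ) - 1 =
      ((1 / 4 - Complex.I * β / (2 * k)) - 1) + 1 / 2 by ring,
    sq_cpow_add_half (cos_half_pos hα), sq_cpow_add_half (sin_half_pos hα),
    show Real.sin α / 2 = Real.cos (α / 2) * Real.sin (α / 2) by
      rw [sin_eq_two_mul_half]; ring]
  push_cast
  ring

theorem const_mul_integral_eq {f g : ℝ → ℂ} {c d : ℂ}
    (h : ∀ α ∈ Set.Ioo 0 Real.pi, c * f α = d * g α) :
    c * ∫ α in (0 : ℝ)..Real.pi, f α = d * ∫ α in (0 : ℝ)..Real.pi, g α := by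
  rw [← intervalIntegral.integral_const_mul, ← intervalIntegral.integral_const_mul,
    intervalIntegral.integral_of_le Real.pi_pos.le, intervalIntegral.integral_of_le Real.pi_pos.le,
    integral_Ioc_eq_integral_Ioo, integral_Ioc_eq_integral_Ioo]
  exact setIntegral_congr_fun measurableSet_Ioo h

theorem parabolicWave_even_eq {k : ℝ} (hk : 0 < k) (β ξ η : ℝ) :
    parabolicWave .even k β ξ η = 2 * ∫ α in (0 : ℝ)..Real.pi,
      kernelZ k β α * cartesianWave .even k α ((ξ ^ 2 - η ^ 2) / 2) (ξ * η) := by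
  have hre := I_mul_div_re k β
  have h := integral_eq_hyp1F1_mul_hyp1F1 (A := 1 / 4 + Complex.I * β / (2 * k))
    (B := 1 / 4 - Complex.I * β / (2 * k)) (b := 1 / 2) le_rfl (by push_cast; ring)
    (by rw [Complex.add_re, hre]; norm_num) (by rw [Complex.sub_re, hre]; norm_num)
    (fun x : ℝ => hasSum_hyp0F1 le_rfl (Complex.I * k * ξ ^ 2) (Complex.I * k * η ^ 2) x)
  rw [integral_comp_half_one_add_cos] at h
  have hpi := Real.pi_pos
  have hG := norm_Gamma_sq (1 / 4) k β
  push_cast at hG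
  have key := const_mul_integral_eq (c := (√k / (2 * Real.pi) : ℝ) *
      Complex.exp (-Complex.I * k * ((ξ ^ 2 + η ^ 2) / 2)))
    (d := (2 * √2 * √(Real.pi * k) : ℝ)) (f := fun α => ((Real.sin α / 2 : ℝ) : ℂ) *
      ((((1 + Real.cos α) / 2 : ℝ) : ℂ) ^ ((1 / 4 + Complex.I * β / (2 * k)) - 1) *
        (1 - (((1 + Real.cos α) / 2 : ℝ) : ℂ)) ^ ((1 / 4 - Complex.I * β / (2 * k)) - 1) *
        (Complex.exp ((Complex.I * k * ξ ^ 2) * (((1 + Real.cos α) / 2 : ℝ) : ℂ)) *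
      Complex.exp ((Complex.I * k * η ^ 2) * (1 - (((1 + Real.cos α) / 2 : ℝ) : ℂ))) *
        hyp0F1 (1 / 2) (Complex.I * k * ξ ^ 2) (Complex.I * k * η ^ 2)
          (((1 + Real.cos α) / 2 : ℝ) : ℂ))))
    (g := fun α => kernelZ k β α * cartesianWave .even k α ((ξ ^ 2 - η ^ 2) / 2) (ξ * η))
    (fun α hα => by
      have h1 := beta_weight_eq_kernelZ hk β hα
      have h2 := exp_mul_exp_half_one_add_cos k ξ η α
      have h3 : hyp0F1 (1 / 2) (Complex.I * k * ξ ^ 2) (Complex.I * k * η ^ 2)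
            (((1 + Real.cos α) / 2 : ℝ) : ℂ) = (Real.cos (k * Real.sin α * (ξ * η)) : ℝ) := by
        rw [hyp0F1, hyp0F1_arg, (hasSum_cos_hypergeometric _).tsum_eq, Complex.ofReal_cos]
      simp only [cartesianWave]
      rw [h3, abs_of_pos hα.1, ← h2, ← mul_assoc (Complex.ofReal (2 * √2 * √(Real.pi * k))), ← h1]
      ring)
  have hcoef : (√k / (2 * Real.pi) : ℝ) * 2 / √Real.pi =
      (2 * √2 * √(Real.pi * k)) * (1 / (2 * √2 * Real.pi ^ 2)) := by
    rw [Real.sqrt_mul hpi.le]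
    field_simp
    rw [Real.sq_sqrt hpi.le]
  have hd : ((2 * √2 * √(Real.pi * k) : ℝ) : ℂ) ≠ 0 := by
    exact_mod_cast (by positivity : (0 : ℝ) < 2 * √2 * √(Real.pi * k)).ne'
  rw [h, hG] at key
  apply mul_left_cancel₀ hd
  rw [mul_left_comm, ← key, parabolicWave, parabolicConst, Complex.ofReal_div, div_eq_mul_one_div]
  have hcoef' := congrArg Complex.ofReal hcoef
  have hΓ : Complex.Gamma ((1 / 2 : ℝ) : ℂ) = (√Real.pi : ℝ) := by
    rw [Complex.Gamma_ofReal, Real.Gamma_one_half_eq]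
  rw [hΓ]
  simp only [Complex.ofReal_mul, Complex.ofReal_div, Complex.ofReal_one, Complex.ofReal_ofNat,
    Complex.ofReal_pow] at hcoef' ⊢
  linear_combination (-(‖Complex.Gamma (1 / 4 + Complex.I * β / (2 * k))‖ : ℂ) ^ 2 *
    Complex.exp (-Complex.I * k * ((ξ ^ 2 + η ^ 2) / 2)) *
      hyp1F1 (1 / 4 + Complex.I * β / (2 * k)) (1 / 2) (Complex.I * k * ξ ^ 2) *
      hyp1F1 (1 / 4 - Complex.I * β / (2 * k)) (1 / 2) (Complex.I * k * η ^ 2)) * hcoef'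

theorem parabolicWave_odd_eq {k : ℝ} (hk : 0 < k) (β ξ η : ℝ) :
    parabolicWave .odd k β ξ η = 2 * ∫ α in (0 : ℝ)..Real.pi,
      kernelZ k β α * cartesianWave .odd k α ((ξ ^ 2 - η ^ 2) / 2) (ξ * η) := by
  have hre := I_mul_div_re k β
  have h := integral_eq_hyp1F1_mul_hyp1F1 (A := 3 / 4 + Complex.I * β / (2 * k))
    (B := 3 / 4 - Complex.I * β / (2 * k)) (b := 3 / 2) (by norm_num) (by push_cast; ring)
    (by rw [Complex.add_re, hre]; norm_num) (by rw [Complex.sub_re, hre]; norm_num)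
    (fun x : ℝ => hasSum_hyp0F1 (by norm_num) (Complex.I * k * ξ ^ 2) (Complex.I * k * η ^ 2) x)
  rw [integral_comp_half_one_add_cos] at h
  have hpi := Real.pi_pos
  have hG := norm_Gamma_sq (3 / 4) k β
  push_cast at hG
  -- The extra factor 2kξη turns the sin α / 2 of the odd weight into k sin α ξη, the prefactor in
  -- the hypergeometric form of the sine.
  have key := const_mul_integral_eq (c := (√k / (2 * Real.pi) : ℝ) *
      Complex.exp (-Complex.I * k * ((ξ ^ 2 + η ^ 2) / 2)) * (2 * (k * (ξ * η))))
    (d := (2 * √2 * √(Real.pi * k) : ℝ)) (f := fun α => ((Real.sin α / 2 : ℝ) : ℂ) *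
      ((((1 + Real.cos α) / 2 : ℝ) : ℂ) ^ ((3 / 4 + Complex.I * β / (2 * k)) - 1) *
        (1 - (((1 + Real.cos α) / 2 : ℝ) : ℂ)) ^ ((3 / 4 - Complex.I * β / (2 * k)) - 1) *
        (Complex.exp ((Complex.I * k * ξ ^ 2) * (((1 + Real.cos α) / 2 : ℝ) : ℂ)) *
      Complex.exp ((Complex.I * k * η ^ 2) * (1 - (((1 + Real.cos α) / 2 : ℝ) : ℂ))) *
        hyp0F1 (3 / 2) (Complex.I * k * ξ ^ 2) (Complex.I * k * η ^ 2)
          (((1 + Real.cos α) / 2 : ℝ) : ℂ))))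
    (g := fun α => kernelZ k β α * cartesianWave .odd k α ((ξ ^ 2 - η ^ 2) / 2) (ξ * η))
    (fun α hα => by
      have h1 := beta_weight_eq_sin_mul_kernelZ hk β hα
      have h2 := exp_mul_exp_half_one_add_cos k ξ η α
      have h3 : ((k * Real.sin α * (ξ * η) : ℝ) : ℂ) *
          hyp0F1 (3 / 2) (Complex.I * k * ξ ^ 2) (Complex.I * k * η ^ 2)
            (((1 + Real.cos α) / 2 : ℝ) : ℂ) = (Real.sin (k * Real.sin α * (ξ * η)) : ℝ) := by
        rw [hyp0F1, hyp0F1_arg, ← tsum_mul_left, (hasSum_sin_hypergeometric _).tsum_eq,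
          Complex.ofReal_sin]
      simp only [cartesianWave]
      rw [abs_of_pos hα.1, ← h3, ← h2]
      generalize hyp0F1 (3 / 2) _ _ _ = H
      generalize Complex.exp _ = E₁
      generalize Complex.exp _ = E₂
      generalize Complex.exp _ = E₃
      generalize Complex.ofReal (√k / (2 * Real.pi)) = N
      simp only [Complex.ofReal_mul, Complex.ofReal_div, Complex.ofReal_ofNat] at h1 ⊢
      linear_combination (N * E₁ * E₂ * E₃ * H * (2 * (k * (ξ * η)))) * h1)
  have hcoef : (√k / (2 * Real.pi) : ℝ) * 2 * 2 * k / (√Real.pi / 2) =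
      (2 * √2 * √(Real.pi * k)) * (√2 * k / Real.pi ^ 2) := by
    rw [Real.sqrt_mul hpi.le]
    field_simp
    rw [Real.sq_sqrt hpi.le, Real.sq_sqrt zero_le_two]
    ring
  have hd : ((2 * √2 * √(Real.pi * k) : ℝ) : ℂ) ≠ 0 := by
    exact_mod_cast (by positivity : (0 : ℝ) < 2 * √2 * √(Real.pi * k)).ne'
  rw [h, hG] at key
  apply mul_left_cancel₀ hd
  rw [mul_left_comm, ← key, parabolicWave, parabolicConst]
  have hcoef' := congrArg Complex.ofReal hcoef
  have hΓ : Complex.Gamma ((3 / 2 : ℝ) : ℂ) = ((√Real.pi / 2 : ℝ) : ℂ) := by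
    rw [Complex.Gamma_ofReal, show (3 / 2 : ℝ) = 1 / 2 + 1 by norm_num,
      Real.Gamma_add_one (by norm_num), Real.Gamma_one_half_eq]
    congr 1; ring
  rw [hΓ]
  simp only [Complex.ofReal_mul, Complex.ofReal_div, Complex.ofReal_ofNat,
    Complex.ofReal_pow] at hcoef' ⊢
  linear_combination (-(‖Complex.Gamma (3 / 4 + Complex.I * β / (2 * k))‖ : ℂ) ^ 2 * (ξ * η) *
    Complex.exp (-Complex.I * k * ((ξ ^ 2 + η ^ 2) / 2)) *
      hyp1F1 (3 / 4 + Complex.I * β / (2 * k)) (3 / 2) (Complex.I * k * ξ ^ 2) *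
      hyp1F1 (3 / 4 - Complex.I * β / (2 * k)) (3 / 2) (Complex.I * k * η ^ 2)) * hcoef'

/-- Parabolic waves as integrals of Cartesian waves. -/
theorem parabolicWave_eq_integral (s : WaveParity) {k : ℝ} (hk : 0 < k) (β ξ η : ℝ) :
    parabolicWave s k β ξ η = 2 * ∫ α in (0 : ℝ)..Real.pi,
      kernelZ k β α * cartesianWave s k α ((ξ ^ 2 - η ^ 2) / 2) (ξ * η) := by
  cases s
  · exact parabolicWave_even_eq hk β ξ η
  · exact parabolicWave_odd_eq hk β ξ η

/-! ### The substitution `cot (α / 2) = exp u` -/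

/-- The angle `α` in `(0, π)` with `cot (α / 2) = exp u`. -/
noncomputable def angle (u : ℝ) : ℝ := 2 * Real.arctan (Real.exp (-u))

theorem angle_mem (u : ℝ) : angle u ∈ Set.Ioo 0 Real.pi := by
  have h1 : 0 < Real.arctan (Real.exp (-u)) := Real.arctan_pos.2 (Real.exp_pos _)
  have h2 := Real.arctan_lt_pi_div_two (Real.exp (-u))
  constructor <;> unfold angle <;> linarith

theorem cot_angle_half (u : ℝ) : Real.cot (angle u / 2) = Real.exp u := by
  rw [angle, mul_div_cancel_left₀ _ two_ne_zero, Real.cot_eq_cos_div_sin, ← inv_div,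
    ← Real.tan_eq_sin_div_cos, Real.tan_arctan, ← Real.exp_neg, neg_neg]

theorem one_add_exp_neg_sq (u : ℝ) :
    1 + Real.exp (-u) ^ 2 = 2 * Real.exp (-u) * Real.cosh u := by
  have h : Real.exp u * Real.exp (-u) = 1 := by rw [← Real.exp_add]; simp
  rw [Real.cosh_eq]
  linear_combination -h

theorem sin_angle (u : ℝ) : Real.sin (angle u) = (Real.cosh u)⁻¹ := by
  have h := one_add_exp_neg_sq u
  have h1 := Real.exp_pos (-u)
  have h2 := Real.cosh_pos u
  rw [angle, Real.sin_two_mul, Real.sin_arctan, Real.cos_arctan, mul_assoc, div_mul_div_comm,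
    Real.mul_self_sqrt (by positivity), h]
  field_simp

theorem cos_angle (u : ℝ) : Real.cos (angle u) = Real.sinh u / Real.cosh u := by
  have h := one_add_exp_neg_sq u
  have h1 := Real.exp_pos (-u)
  have h2 := Real.cosh_pos u
  have h3 : Real.exp u * Real.exp (-u) = 1 := by rw [← Real.exp_add]; simp
  rw [angle, Real.cos_two_mul, Real.cos_arctan, div_pow, Real.sq_sqrt (by positivity), h]
  field_simp
  rw [Real.sinh_eq, Real.cosh_eq]
  linear_combination -h3

theorem hasDerivAt_angle (u : ℝ) : HasDerivAt angle (-(Real.cosh u)⁻¹) u := by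
  have h := ((hasDerivAt_neg u).exp.arctan).const_mul 2
  refine h.congr_deriv ?_
  rw [one_add_exp_neg_sq]
  have h1 := Real.exp_pos (-u)
  have h2 := Real.cosh_pos u
  field_simp

theorem angle_injective : Function.Injective angle := fun a b h => by
  have := cot_angle_half a
  rw [h, cot_angle_half] at this
  exact (Real.exp_injective this).symm

theorem exists_angle_eq {α : ℝ} (hα : α ∈ Set.Ioo 0 Real.pi) : ∃ u, angle u = α := by
  have ht : 0 < Real.tan (α / 2) :=
    Real.tan_pos_of_pos_of_lt_pi_div_two (by linarith [hα.1]) (by linarith [hα.2])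
  refine ⟨-Real.log (Real.tan (α / 2)), ?_⟩
  rw [angle, neg_neg, Real.exp_log ht, Real.arctan_tan (by linarith [hα.1, hα.2])
    (by linarith [hα.2])]
  ring

theorem image_angle : angle '' Set.univ = Set.Ioo 0 Real.pi := by
  ext α
  constructor
  · rintro ⟨u, -, rfl⟩; exact angle_mem u
  · intro h
    obtain ⟨u, hu⟩ := exists_angle_eq h
    exact ⟨u, trivial, hu⟩

theorem integral_comp_angle (F : ℝ → ℂ) :
    ∫ α in (0 : ℝ)..Real.pi, F α = ∫ u : ℝ, ((Real.cosh u : ℝ) : ℂ)⁻¹ * F (angle u) := by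
  rw [intervalIntegral.integral_of_le Real.pi_pos.le, integral_Ioc_eq_integral_Ioo, ← image_angle,
    integral_image_eq_integral_abs_deriv_smul MeasurableSet.univ
      (fun u _ => (hasDerivAt_angle u).hasDerivWithinAt) angle_injective.injOn, setIntegral_univ]
  congr 1 with u
  rw [abs_neg, abs_of_pos (inv_pos.2 (Real.cosh_pos u)), Complex.real_smul, Complex.ofReal_inv]

theorem intervalIntegrable_iff_comp_angle (F : ℝ → ℂ) :
    IntervalIntegrable F volume 0 Real.pi ↔
      Integrable fun u : ℝ => ((Real.cosh u : ℝ) : ℂ)⁻¹ * F (angle u) := by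
  rw [intervalIntegrable_iff_integrableOn_Ioo_of_le Real.pi_pos.le, ← image_angle,
    integrableOn_image_iff_integrableOn_abs_deriv_smul MeasurableSet.univ
      (fun u _ => (hasDerivAt_angle u).hasDerivWithinAt) angle_injective.injOn, integrableOn_univ]
  refine integrable_congr (Eventually.of_forall fun u => ?_)
  simp only
  rw [abs_neg, abs_of_pos (inv_pos.2 (Real.cosh_pos u)), Complex.real_smul, Complex.ofReal_inv]

/-- A power of exp u is a character of the line, of frequency β/k, and sin α = 1 / cosh u supplies
an amplitude independent of β. This makes Z a Fourier kernel. -/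
theorem kernelZ_angle (k β u : ℝ) :
    kernelZ k β (angle u) = Complex.exp (Complex.I * (β * u / k : ℝ)) *
      (√(Real.cosh u) / (2 * √(Real.pi * k)) : ℝ) := by
  rw [kernelZ, abs_of_pos (angle_mem u).1, cot_angle_half, sin_angle,
    Complex.cpow_def_of_ne_zero (by exact_mod_cast (Real.exp_pos u).ne'),
    ← Complex.ofReal_log (Real.exp_pos u).le, Real.log_exp, ← div_eq_mul_inv,
    Real.sqrt_div' _ (Real.cosh_pos u).le, mul_div_assoc', div_eq_mul_inv, ← Complex.ofReal_inv,
    ← mul_div_assoc, inv_div]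
  congr 2
  push_cast
  ring

theorem conj_kernelZ_angle (k β u : ℝ) :
    conj (kernelZ k β (angle u)) = Complex.exp (-(Complex.I * (β * u / k : ℝ))) *
      (√(Real.cosh u) / (2 * √(Real.pi * k)) : ℝ) := by
  rw [kernelZ_angle, map_mul, Complex.conj_ofReal, ← Complex.exp_conj, map_mul, Complex.conj_I,
    Complex.conj_ofReal, neg_mul]

/-- Transported from the integrability of Z at k = 1, β = 0, where the character is trivial. -/
theorem integrable_inv_sqrt_cosh : Integrable fun u : ℝ => (√(Real.cosh u))⁻¹ := by
  have h := (intervalIntegrable_iff_comp_angle _).1 (intervalIntegrable_kernelZ one_pos 0)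
  have h2 := (h.const_mul ((2 * √Real.pi : ℝ) : ℂ)).re
  refine h2.congr (Eventually.of_forall fun u => ?_)
  have h3 : √(Real.cosh u) ≠ 0 := (Real.sqrt_pos.2 (Real.cosh_pos u)).ne'
  have h4 : √Real.pi ≠ 0 := (Real.sqrt_pos.2 Real.pi_pos).ne'
  simp only [kernelZ_angle]
  rw [zero_mul, zero_div, Complex.ofReal_zero, mul_zero, Complex.exp_zero, one_mul,
    ← Complex.ofReal_inv, ← Complex.ofReal_mul, ← Complex.ofReal_mul]
  simp only [RCLike.re_to_complex, Complex.ofReal_re, mul_one]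
  have h5 : Real.cosh u = √(Real.cosh u) ^ 2 := (Real.sq_sqrt (Real.cosh_pos u).le).symm
  conv_lhs => rw [h5, Real.sqrt_sq (Real.sqrt_nonneg _)]
  field_simp

/-! ### Fourier inversion for functions of the angle -/

/-- The function `G` of the angle, seen on the line, with the weight `(cosh u) ^ (-1 / 2)`. -/
noncomputable def profile (G : ℝ → ℂ) (u : ℝ) : ℂ := ((√(Real.cosh u))⁻¹ : ℝ) * G (angle u)

/-- The operator that corresponds to `d / du`. -/
noncomputable def profileDeriv (G : ℝ → ℂ) (α : ℝ) : ℂ :=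
  -((Real.cos α : ℝ) : ℂ) / 2 * G α - (Real.sin α : ℝ) * deriv G α

theorem contDiff_profileDeriv {G : ℝ → ℂ} (hG : ContDiff ℝ ∞ G) :
    ContDiff ℝ ∞ (profileDeriv G) := by
  have h1 := (contDiff_infty_iff_deriv.1 hG).2
  have hc : ContDiff ℝ ∞ fun α : ℝ => ((Real.cos α : ℝ) : ℂ) :=
    Complex.ofRealCLM.contDiff.comp Real.contDiff_cos
  have hs : ContDiff ℝ ∞ fun α : ℝ => ((Real.sin α : ℝ) : ℂ) :=
    Complex.ofRealCLM.contDiff.comp Real.contDiff_sin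
  exact ((hc.neg.div_const 2).mul hG).sub (hs.mul h1)

theorem hasDerivAt_inv_sqrt_cosh (u : ℝ) :
    HasDerivAt (fun u => (√(Real.cosh u))⁻¹)
      (-(Real.sinh u / Real.cosh u) / 2 * (√(Real.cosh u))⁻¹) u := by
  have h0 := Real.cosh_pos u
  have h1 := (Real.sqrt_pos.2 h0).ne'
  refine (((Real.hasDerivAt_cosh u).sqrt h0.ne').inv h1).congr_deriv ?_
  rw [Real.sq_sqrt h0.le]
  field_simp

/-- The weight has logarithmic derivative -tanh u / 2 = -cos α / 2, and dα/du = -sin α. So profiles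
of smooth functions are closed under differentiation, and every derivative is integrable. -/
theorem hasDerivAt_profile {G : ℝ → ℂ} (hG : ContDiff ℝ ∞ G) (u : ℝ) :
    HasDerivAt (profile G) (profile (profileDeriv G) u) u := by
  have hGd : HasDerivAt G (deriv G (angle u)) (angle u) :=
    ((contDiff_infty_iff_deriv.1 hG).1 _).hasDerivAt
  have h := (hasDerivAt_inv_sqrt_cosh u).ofReal_comp.mul (hGd.scomp u (hasDerivAt_angle u))
  refine h.congr_deriv ?_
  simp only [profile, profileDeriv, sin_angle, cos_angle, Complex.real_smul, Function.comp]
  push_cast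
  ring

theorem integrable_profile {G : ℝ → ℂ} (hG : ContDiff ℝ ∞ G) : Integrable (profile G) := by
  obtain ⟨M, hM⟩ := isCompact_Icc.exists_bound_of_continuousOn (s := Set.Icc 0 Real.pi)
    hG.continuous.continuousOn
  have hc : Continuous (profile G) :=
    continuous_iff_continuousAt.2 fun u => (hasDerivAt_profile hG u).continuousAt
  refine (integrable_inv_sqrt_cosh.mul_const M).mono' hc.aestronglyMeasurable
    (Eventually.of_forall fun u => ?_)
  have h := angle_mem u
  rw [profile, norm_mul, Complex.norm_real, Real.norm_of_nonneg (by positivity)]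
  exact mul_le_mul_of_nonneg_left (hM _ ⟨h.1.le, h.2.le⟩) (by positivity)

-- The profile and its second derivative are integrable, so the transform is bounded by M / (1 +
-- x²).
open FourierTransform in
theorem integrable_fourier_profile {G : ℝ → ℂ} (hG : ContDiff ℝ ∞ G) :
    Integrable (𝓕 (profile G)) := by
  have hd {G : ℝ → ℂ} (hG : ContDiff ℝ ∞ G) :
      𝓕 (profile (profileDeriv G)) = fun x : ℝ => (2 * ↑Real.pi * Complex.I * x) • 𝓕 (profile G) x := by
    have e : deriv (profile G) = profile (profileDeriv G) :=
      funext fun u => (hasDerivAt_profile hG u).deriv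
    rw [← e]
    exact Real.fourier_deriv (integrable_profile hG)
      (fun u => (hasDerivAt_profile hG u).differentiableAt)
      (e ▸ integrable_profile (contDiff_profileDeriv hG))
  have hb {h : ℝ → ℂ} (x : ℝ) : ‖𝓕 h x‖ ≤ ∫ v, ‖h v‖ :=
    VectorFourier.norm_fourierIntegral_le_integral_norm _ _ _ _ _
  have hG1 := contDiff_profileDeriv hG
  have hc : Continuous (𝓕 (profile G)) :=
    VectorFourier.fourierIntegral_continuous Real.continuous_fourierChar
      (innerSL ℝ).continuous₂ (integrable_profile hG)
  set M := (∫ v, ‖profile G v‖) + ∫ v, ‖profile (profileDeriv (profileDeriv G)) v‖ with hM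
  refine (integrable_inv_one_add_sq.mul_const M).mono' hc.aestronglyMeasurable
    (Eventually.of_forall fun x => ?_)
  have h0 := hb (h := profile G) x
  have h2 := hb (h := profile (profileDeriv (profileDeriv G))) x
  rw [hd hG1, hd hG] at h2
  simp only [norm_smul, norm_mul, Complex.norm_real, Complex.norm_I, Complex.norm_ofNat,
    Real.norm_eq_abs, abs_of_pos Real.pi_pos, mul_one] at h2
  have h3 : 2 * Real.pi * |x| * (2 * Real.pi * |x| * ‖𝓕 (profile G) x‖) =
      4 * Real.pi ^ 2 * (x ^ 2 * ‖𝓕 (profile G) x‖) := by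
    rw [← sq_abs x]; ring
  have h4 : x ^ 2 * ‖𝓕 (profile G) x‖ ≤ 4 * Real.pi ^ 2 * (x ^ 2 * ‖𝓕 (profile G) x‖) :=
    le_mul_of_one_le_left (by positivity) (by nlinarith [Real.pi_gt_three])
  rw [inv_mul_eq_div, le_div_iff₀ (by positivity)]
  linarith

open FourierTransform in
/-- Fourier inversion, in the normalization `∫ exp (i β u / k) h u du`. -/
theorem fourier_inversion_scaled {k : ℝ} (hk : 0 < k) {h : ℝ → ℂ} (hi : Integrable h)
    (hf : Integrable (𝓕 h)) (hc : Continuous h) (u₀ : ℝ) :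
    (Integrable fun β : ℝ => Complex.exp (-(Complex.I * (β * u₀ / k : ℝ))) *
      ∫ u : ℝ, Complex.exp (Complex.I * (β * u / k : ℝ)) * h u) ∧
    ∫ β : ℝ, Complex.exp (-(Complex.I * (β * u₀ / k : ℝ))) *
      ∫ u : ℝ, Complex.exp (Complex.I * (β * u / k : ℝ)) * h u = (2 * Real.pi * k : ℝ) * h u₀ := by
  have hpi := Real.pi_pos
  -- The character of `𝓕` is exp(-2πiuw); w = Rβ makes it exp(iβu/k), and the change of variable
  -- contributes 1/|R| = 2πk.
  set R : ℝ := -(2 * Real.pi * k)⁻¹ with hR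
  have hR0 : R ≠ 0 := neg_ne_zero.2 (inv_ne_zero (by positivity))
  set g : ℝ → ℂ := fun w => Complex.exp ((2 * Real.pi * (w * u₀) : ℝ) * Complex.I) * 𝓕 h w with hg
  have e : (fun β : ℝ => Complex.exp (-(Complex.I * (β * u₀ / k : ℝ))) *
      ∫ u : ℝ, Complex.exp (Complex.I * (β * u / k : ℝ)) * h u) = fun β => g (R * β) := by
    funext β
    simp only [hg, Real.fourier_eq', smul_eq_mul, RCLike.inner_apply, conj_trivial]
    congr 2
    · rw [hR]; push_cast; field_simp
    · funext u
      congr 2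
      rw [hR]; push_cast; field_simp
  have hgi : Integrable g := by
    refine hf.bdd_mul (c := 1) (by fun_prop) (Eventually.of_forall fun w => ?_)
    rw [Complex.norm_exp_ofReal_mul_I]
  have hinv := hi.fourierInv_fourier_eq hf (v := u₀) hc.continuousAt
  rw [Real.fourierInv_eq'] at hinv
  simp only [smul_eq_mul, RCLike.inner_apply, conj_trivial] at hinv
  rw [e]
  refine ⟨hgi.comp_mul_left' hR0, ?_⟩
  rw [Measure.integral_comp_mul_left, ← hinv, hR, inv_neg, inv_inv, abs_neg,
    abs_of_pos (by positivity), Complex.real_smul]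
  congr 2
  funext w
  simp only [hg, mul_comm w u₀]

/-- The Jacobian 1 / cosh u and the amplitude √(cosh u) combine to the weight of the profile. -/
theorem integral_kernelZ_mul {k : ℝ} (β : ℝ) (G : ℝ → ℂ) :
    ∫ α in (0 : ℝ)..Real.pi, kernelZ k β α * G α =
      ((2 * √(Real.pi * k))⁻¹ : ℝ) *
        ∫ u : ℝ, Complex.exp (Complex.I * (β * u / k : ℝ)) * profile G u := by
  rw [integral_comp_angle, ← integral_const_mul]
  congr 1 with u
  rw [kernelZ_angle, profile]
  have h : (Real.cosh u)⁻¹ * √(Real.cosh u) = (√(Real.cosh u))⁻¹ := by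
    have h0 := Real.sqrt_pos.2 (Real.cosh_pos u)
    have h5 : Real.cosh u = √(Real.cosh u) ^ 2 := (Real.sq_sqrt (Real.cosh_pos u).le).symm
    conv_lhs => rw [h5, Real.sqrt_sq h0.le]
    field_simp
  rw [← h]
  push_cast
  ring

/-- Completeness of the kernels `Z` in the angle. -/
theorem integral_conj_kernelZ_mul_integral {k : ℝ} (hk : 0 < k) {G : ℝ → ℂ}
    (hG : ContDiff ℝ ∞ G) {α' : ℝ} (hα' : α' ∈ Set.Ioo 0 Real.pi) :
    (Integrable fun β : ℝ => conj (kernelZ k β α') *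
      ∫ α in (0 : ℝ)..Real.pi, kernelZ k β α * G α) ∧
    ∫ β : ℝ, conj (kernelZ k β α') * ∫ α in (0 : ℝ)..Real.pi, kernelZ k β α * G α = G α' / 2 := by
  obtain ⟨u₀, rfl⟩ := exists_angle_eq hα'
  have hpi := Real.pi_pos
  have hc : Continuous (profile G) :=
    continuous_iff_continuousAt.2 fun u => (hasDerivAt_profile hG u).continuousAt
  obtain ⟨h1, h2⟩ := fourier_inversion_scaled hk (integrable_profile hG)
    (integrable_fourier_profile hG) hc u₀
  have e : (fun β : ℝ => conj (kernelZ k β (angle u₀)) *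
      ∫ α in (0 : ℝ)..Real.pi, kernelZ k β α * G α) = fun β : ℝ =>
      ((√(Real.cosh u₀) / (2 * √(Real.pi * k)) * (2 * √(Real.pi * k))⁻¹ : ℝ) : ℂ) *
      (Complex.exp (-(Complex.I * (β * u₀ / k : ℝ))) *
      ∫ u : ℝ, Complex.exp (Complex.I * (β * u / k : ℝ)) * profile G u) := by
    funext β
    rw [integral_kernelZ_mul, conj_kernelZ_angle]
    push_cast
    ring
  rw [e]
  refine ⟨h1.const_mul _, ?_⟩
  rw [integral_const_mul, h2, profile, ← mul_assoc, ← mul_assoc, ← Complex.ofReal_mul,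
    ← Complex.ofReal_mul]
  -- The two kernel constants give 1/(4πk) and the inversion gives 2πk; the powers of cosh cancel.
  have h3 : √(Real.cosh u₀) / (2 * √(Real.pi * k)) * (2 * √(Real.pi * k))⁻¹ *
      (2 * Real.pi * k) * (√(Real.cosh u₀))⁻¹ = 1 / 2 := by
    have h5 := Real.sqrt_pos.2 (Real.cosh_pos u₀)
    have h6 : √(Real.pi * k) ^ 2 = Real.pi * k := Real.sq_sqrt (by positivity)
    have h7 : 0 < √(Real.pi * k) := Real.sqrt_pos.2 (by positivity)
    field_simp
    rw [h6]
  rw [h3]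
  push_cast
  ring

/-! ### Orthogonality and completeness of the kernels -/

theorem integral_neg_pi_pi_eq {F : ℝ → ℂ} (h₁ : IntervalIntegrable F volume 0 Real.pi)
    (h₂ : IntervalIntegrable (fun α => F (-α)) volume 0 Real.pi) :
    IntervalIntegrable F volume (-Real.pi) Real.pi ∧
      ∫ α in (-Real.pi)..Real.pi, F α = ∫ α in (0 : ℝ)..Real.pi, (F α + F (-α)) := by
  have h₃ : IntervalIntegrable F volume (-Real.pi) 0 := by
    have := (IntervalIntegrable.iff_comp_neg (by simp)).1 h₂
    simpa using this.symm
  refine ⟨h₃.trans h₁, ?_⟩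
  rw [intervalIntegral.integral_add h₁ h₂, intervalIntegral.integral_comp_neg, neg_zero, add_comm,
    intervalIntegral.integral_add_adjacent_intervals h₃ h₁]

theorem kernelZ_abs (k β α : ℝ) : kernelZ k β |α| = kernelZ k β α := by
  simp only [kernelZ, abs_abs]

/-- Z is even in α, so folding (-π, π) onto (0, π) replaces f by f(α) + f(-α), whose value at |α'|
does not depend on the sign of α'. -/
theorem kernelZ_completeness_angle {k : ℝ} (hk : 0 < k) {α' : ℝ} (h0 : 0 < |α'|)
    (hpi : |α'| < Real.pi) {f : ℝ → ℂ} (hf : ContDiff ℝ ∞ f) :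
    (∀ β : ℝ, IntervalIntegrable
      (fun α : ℝ => kernelZ k β α * conj (kernelZ k β α') * f α) volume (-Real.pi) Real.pi) ∧
    Integrable (fun β : ℝ =>
      ∫ α in (-Real.pi)..Real.pi, kernelZ k β α * conj (kernelZ k β α') * f α) ∧
    (∫ β : ℝ, ∫ α in (-Real.pi)..Real.pi, kernelZ k β α * conj (kernelZ k β α') * f α) =
      (f α' + f (-α')) / 2 := by
  have hfn : ContDiff ℝ ∞ fun α => f (-α) := hf.comp contDiff_neg
  have hi {g : ℝ → ℂ} (hg : ContDiff ℝ ∞ g) (β : ℝ) : IntervalIntegrable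
      (fun α : ℝ => kernelZ k β α * conj (kernelZ k β α') * g α) volume 0 Real.pi :=
    ((intervalIntegrable_kernelZ hk β).mul_const _).mul_continuousOn hg.continuous.continuousOn
  have hs (β : ℝ) := integral_neg_pi_pi_eq
    (F := fun α => kernelZ k β α * conj (kernelZ k β α') * f α) (hi hf β)
    (by simpa only [kernelZ_neg] using hi hfn β)
  obtain ⟨h1, h2⟩ := integral_conj_kernelZ_mul_integral hk (hf.add hfn) ⟨h0, hpi⟩
  have e (β : ℝ) : ∫ α in (-Real.pi)..Real.pi, kernelZ k β α * conj (kernelZ k β α') * f α =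
      conj (kernelZ k β |α'|) * ∫ α in (0 : ℝ)..Real.pi, kernelZ k β α * (f α + f (-α)) := by
    rw [(hs β).2, ← intervalIntegral.integral_const_mul, kernelZ_abs]
    congr 1 with α
    rw [kernelZ_neg]
    ring
  refine ⟨fun β => (hs β).1, ?_, ?_⟩
  · simp only [e]; exact h1
  · simp only [e]
    rw [h2]
    rcases abs_choice α' with h | h <;> rw [h]
    rw [neg_neg, add_comm]

-- At a common angle the two amplitudes multiply to cosh u / (4πk), which the Jacobian reduces to a
-- constant. What remains is Fourier inversion with u and β exchanged; the two halves of (-π, π)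
-- give the factor 2 that makes the total constant 1.
open FourierTransform in
theorem kernelZ_completeness_parameter {k : ℝ} (hk : 0 < k) (β' : ℝ) (f : 𝓢(ℝ, ℂ)) :
    (∀ α : ℝ, 0 < |α| → |α| < Real.pi →
      Integrable (fun β : ℝ => kernelZ k β α * conj (kernelZ k β' α) * f β)) ∧
    IntervalIntegrable
      (fun α : ℝ => ∫ β : ℝ, kernelZ k β α * conj (kernelZ k β' α) * f β)
      volume (-Real.pi) Real.pi ∧
    (∫ α in (-Real.pi)..Real.pi, ∫ β : ℝ, kernelZ k β α * conj (kernelZ k β' α) * f β) =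
      f β' := by
  have hpi := Real.pi_pos
  have hfF : Integrable (𝓕 (f : ℝ → ℂ)) := by
    rw [← SchwartzMap.fourier_coe]; exact SchwartzMap.integrable _
  obtain ⟨h1, h2⟩ := fourier_inversion_scaled hk f.integrable hfF f.continuous β'
  have hZ (β u : ℝ) : kernelZ k β (angle u) * conj (kernelZ k β' (angle u)) =
      (Real.cosh u / (4 * (Real.pi * k)) : ℝ) *
      (Complex.exp (-(Complex.I * (u * β' / k : ℝ))) * Complex.exp (Complex.I * (u * β / k : ℝ))) := by
    have h3 : Real.cosh u / (4 * (Real.pi * k)) =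
        √(Real.cosh u) / (2 * √(Real.pi * k)) * (√(Real.cosh u) / (2 * √(Real.pi * k))) := by
      rw [div_mul_div_comm, Real.mul_self_sqrt (Real.cosh_pos u).le, mul_mul_mul_comm,
        Real.mul_self_sqrt (by positivity)]
      norm_num
    rw [kernelZ_angle, conj_kernelZ_angle, h3, mul_comm β, mul_comm β']
    push_cast
    ring
  set J : ℝ → ℂ := fun α => ∫ β : ℝ, kernelZ k β α * conj (kernelZ k β' α) * f β with hJ
  have hJn (α : ℝ) : J (-α) = J α := by simp only [hJ, kernelZ_neg]
  have e : (fun u : ℝ => ((Real.cosh u : ℝ) : ℂ)⁻¹ * J (angle u)) = fun u : ℝ =>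
      (((4 * (Real.pi * k))⁻¹ : ℝ) : ℂ) * (Complex.exp (-(Complex.I * (u * β' / k : ℝ))) *
        ∫ β : ℝ, Complex.exp (Complex.I * (u * β / k : ℝ)) * f β) := by
    funext u
    have h4 : ((Real.cosh u : ℝ) : ℂ) ≠ 0 := by exact_mod_cast (Real.cosh_pos u).ne'
    simp only [hJ]
    rw [← integral_const_mul, ← integral_const_mul, ← integral_const_mul]
    congr 1 with β
    rw [hZ, Complex.ofReal_div]
    push_cast [-Complex.ofReal_cosh]
    field_simp
  have hJi : IntervalIntegrable J volume 0 Real.pi := by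
    rw [intervalIntegrable_iff_comp_angle, e]
    exact h1.const_mul _
  obtain ⟨h5, h6⟩ := integral_neg_pi_pi_eq hJi (by simpa only [hJn] using hJi)
  refine ⟨fun α h0 hp => ?_, h5, ?_⟩
  · obtain ⟨u, hu⟩ := exists_angle_eq ⟨h0, hp⟩
    simp only [← kernelZ_abs k _ α, ← hu, hZ]
    refine f.integrable.bdd_mul (c := ‖((Real.cosh u / (4 * (Real.pi * k)) : ℝ) : ℂ)‖)
      (by fun_prop) (Eventually.of_forall fun β => ?_)
    rw [norm_mul, norm_mul, mul_comm Complex.I, mul_comm Complex.I, ← neg_mul,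
      ← Complex.ofReal_neg, Complex.norm_exp_ofReal_mul_I, Complex.norm_exp_ofReal_mul_I]
    simp
  · rw [h6]
    simp only [hJn, ← two_mul]
    rw [intervalIntegral.integral_const_mul, integral_comp_angle, e, integral_const_mul, h2,
      ← mul_assoc, ← mul_assoc]
    have h7 : (2 : ℂ) * (((4 * (Real.pi * k))⁻¹ : ℝ) : ℂ) * (2 * Real.pi * k : ℝ) = 1 := by
      have h8 : (2 : ℝ) * (4 * (Real.pi * k))⁻¹ * (2 * Real.pi * k) = 1 := by
        field_simp; norm_num
      exact_mod_cast h8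
    rw [h7, one_mul]

/-- Removing |α| yields a function smooth on the whole line, as the completeness relation requires.
-/
theorem exists_contDiff_eq_cartesianWave (s : WaveParity) (k x y : ℝ) :
    ∃ G : ℝ → ℂ, ContDiff ℝ ∞ G ∧ ∀ α, cartesianWave s k α x y = G |α| := by
  have hc : ContDiff ℝ ∞ fun α : ℝ => ((k * x * Real.cos α : ℝ) : ℂ) :=
    Complex.ofRealCLM.contDiff.comp (contDiff_const.mul Real.contDiff_cos)
  have he : ContDiff ℝ ∞ fun α : ℝ => ((√k / (2 * Real.pi) : ℝ) : ℂ) *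
      Complex.exp (Complex.I * (k * x * Real.cos α : ℝ)) :=
    contDiff_const.mul (contDiff_const.mul hc).cexp
  have hs : ContDiff ℝ ∞ fun α : ℝ => k * Real.sin α * y :=
    (contDiff_const.mul Real.contDiff_sin).mul contDiff_const
  cases s
  · exact ⟨_, he.mul (Complex.ofRealCLM.contDiff.comp hs.cos), fun α => rfl⟩
  · exact ⟨_, he.mul (Complex.ofRealCLM.contDiff.comp hs.sin), fun α => rfl⟩

/-- The integral representation of the parabolic wave is fed into completeness in the angle; its
factor 2 cancels the 1/2. -/
theorem cartesianWave_eq_integral (s : WaveParity) {k : ℝ} (hk : 0 < k) {α : ℝ} (ξ η : ℝ)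
    (h0 : 0 < |α|) (hp : |α| < Real.pi) :
    Integrable (fun β : ℝ => conj (kernelZ k β α) * parabolicWave s k β ξ η) ∧
    cartesianWave s k α ((ξ ^ 2 - η ^ 2) / 2) (ξ * η) =
      ∫ β : ℝ, conj (kernelZ k β α) * parabolicWave s k β ξ η := by
  obtain ⟨G, hG, hGe⟩ := exists_contDiff_eq_cartesianWave s k ((ξ ^ 2 - η ^ 2) / 2) (ξ * η)
  obtain ⟨h1, h2⟩ := integral_conj_kernelZ_mul_integral hk hG ⟨h0, hp⟩
  have e : (fun β : ℝ => conj (kernelZ k β α) * parabolicWave s k β ξ η) = fun β : ℝ =>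
      2 * (conj (kernelZ k β |α|) * ∫ α in (0 : ℝ)..Real.pi, kernelZ k β α * G α) := by
    funext β
    rw [parabolicWave_eq_integral s hk, kernelZ_abs, mul_left_comm]
    congr 2
    refine intervalIntegral.integral_congr fun a ha => ?_
    rw [Set.uIcc_of_le Real.pi_pos.le] at ha
    simp only [hGe, abs_of_nonneg ha.1]
  rw [e]
  refine ⟨h1.const_mul 2, ?_⟩
  rw [integral_const_mul, h2, hGe]
  ring

/-! ### Bessel functions and the Jacobi-Anger expansion -/

theorem summable_besselJ (n : ℕ) (t : ℝ) :
    Summable fun j : ℕ =>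
      (-1 : ℝ) ^ j / ((j.factorial : ℝ) * ((j + n).factorial : ℝ)) * (t / 2) ^ (2 * j + n) := by
  refine Summable.of_norm_bounded
    ((Real.summable_pow_div_factorial ((t / 2) ^ 2)).mul_left (|t / 2| ^ n)) fun j => ?_
  rw [norm_mul, norm_div, norm_pow, norm_neg, norm_one, one_pow, norm_mul, Real.norm_natCast,
    Real.norm_natCast, norm_pow, Real.norm_eq_abs, pow_add, pow_mul, sq_abs]
  have h1 : (1 : ℝ) ≤ (j + n).factorial := by exact_mod_cast Nat.succ_le_of_lt (Nat.factorial_pos _)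
  have h2 : (0 : ℝ) < j.factorial := by exact_mod_cast Nat.factorial_pos _
  have h3 : 1 / ((j.factorial : ℝ) * ((j + n).factorial : ℝ)) ≤ 1 / j.factorial :=
    one_div_le_one_div_of_le h2 (le_mul_of_one_le_right h2.le h1)
  calc _ ≤ 1 / (j.factorial : ℝ) * (((t / 2) ^ 2) ^ j * |t / 2| ^ n) := by gcongr
    _ = _ := by ring

/-- The leading term A dominates: the terms j ≥ 1 are bounded by A/4, A/16, … and add up to at most
A/3. -/
theorem besselJ_one_ne_zero (n : ℕ) : besselJ n 1 ≠ 0 := by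
  have hs := summable_besselJ n 1
  rw [besselJ, hs.tsum_eq_zero_add]
  set A : ℝ := (1 / 2) ^ n / n.factorial with hA
  have hA0 : 0 < A := by positivity
  have hg : HasSum (fun j : ℕ => A * ((1 / 4) ^ j * (1 / 4))) (A * (4 / 3 * (1 / 4))) := by
    have := hasSum_geometric_of_lt_one (r := (1 / 4 : ℝ)) (by norm_num) (by norm_num)
    rw [show ((1 : ℝ) - 1 / 4)⁻¹ = 4 / 3 by norm_num] at this
    exact (this.mul_right (1 / 4)).mul_left A
  have hb := tsum_of_norm_bounded (f := fun j : ℕ => (-1 : ℝ) ^ (j + 1) /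
    (((j + 1).factorial : ℝ) * ((j + 1 + n).factorial : ℝ)) * (1 / 2) ^ (2 * (j + 1) + n)) hg
    fun j => by
      rw [norm_mul, norm_div, norm_pow, norm_neg, norm_one, one_pow, norm_mul, Real.norm_natCast,
        Real.norm_natCast, norm_pow, Real.norm_of_nonneg (by norm_num : (0 : ℝ) ≤ 1 / 2), pow_add,
        pow_mul, hA]
      have h1 : (1 : ℝ) ≤ (j + 1).factorial := by
        exact_mod_cast Nat.succ_le_of_lt (Nat.factorial_pos _)
      have h2 : (0 : ℝ) < n.factorial := by exact_mod_cast Nat.factorial_pos _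
      have h3 : (n.factorial : ℝ) ≤ (j + 1 + n).factorial := by
        exact_mod_cast Nat.factorial_le (Nat.le_add_left _ _)
      have h4 : 1 / (((j + 1).factorial : ℝ) * ((j + 1 + n).factorial : ℝ)) ≤ 1 / n.factorial :=
        one_div_le_one_div_of_le h2 (h3.trans (le_mul_of_one_le_left (by positivity) h1))
      calc _ ≤ 1 / (n.factorial : ℝ) * (((1 / 2) ^ 2) ^ (j + 1) * (1 / 2) ^ n) := by gcongr
        _ = _ := by rw [pow_succ]; norm_num; ring
  rw [Real.norm_eq_abs, abs_le] at hb
  have h0 : (-1 : ℝ) ^ 0 / (((0 : ℕ).factorial : ℝ) * ((0 + n).factorial : ℝ)) *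
      (1 / 2) ^ (2 * 0 + n) = A := by
    simp [hA]; ring
  rw [h0]
  intro h
  linarith [hb.1]

/-- The integer `p - q` and the minimum of `p` and `q` determine the pair `(p, q)`. -/
def diffMinEquiv : ℤ × ℕ ≃ ℕ × ℕ where
  toFun t := (t.2 + t.1.toNat, t.2 + (-t.1).toNat)
  invFun p := ((p.1 : ℤ) - p.2, min p.1 p.2)
  left_inv := by rintro ⟨m, j⟩; simp only [Prod.mk.injEq]; omega
  right_inv := by rintro ⟨p, q⟩; simp only [Prod.mk.injEq]; omega

theorem hasSum_diffMin {f g : ℕ → ℂ} {a b : ℂ} (hf : Summable fun n => ‖f n‖)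
    (hg : Summable fun n => ‖g n‖) (ha : HasSum f a) (hb : HasSum g b) :
    HasSum (fun q : ℤ × ℕ => f (q.2 + q.1.toNat) * g (q.2 + (-q.1).toNat)) (a * b) :=
  (diffMinEquiv.hasSum_iff (f := fun p : ℕ × ℕ => f p.1 * g p.2)).2
    (HasSum.mul ha hb (summable_mul_of_summable_norm hf hg))

theorem jacobiAnger_monomial (t E F : ℂ) (h : E * F = 1) (j n : ℕ) :
    (Complex.I * t / 2 * E) ^ (j + n) * (Complex.I * t / 2 * F) ^ j =
      Complex.I ^ n * E ^ n * ((-1) ^ j * (t / 2) ^ (2 * j + n)) := by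
  calc _ = (E * F) ^ j * E ^ n * ((Complex.I ^ 2) ^ j * Complex.I ^ n * (t / 2) ^ (2 * j + n)) := by
        ring
    _ = _ := by rw [h, Complex.I_sq]; ring

/-- Exponents p = j + m⁺ and q = j + m⁻ leave the phase of p - q = m, while i^(p+q) = i^|m| (-1)^j
supplies the sign of the Bessel series. -/
theorem jacobiAnger_term (t θ : ℝ) (m : ℤ) (j : ℕ) :
    (Complex.I * t / 2 * Complex.exp (Complex.I * θ)) ^ (j + m.toNat) / (j + m.toNat).factorial *
      ((Complex.I * t / 2 * Complex.exp (-(Complex.I * θ))) ^ (j + (-m).toNat) /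
        (j + (-m).toNat).factorial) =
    Complex.I ^ m.natAbs * Complex.exp (Complex.I * m * θ) * (((-1 : ℝ) ^ j /
      ((j.factorial : ℝ) * ((j + m.natAbs).factorial : ℝ)) * (t / 2) ^ (2 * j + m.natAbs) : ℝ) : ℂ) := by
  have hE : Complex.exp (Complex.I * θ) * Complex.exp (-(Complex.I * θ)) = 1 := by
    rw [← Complex.exp_add, add_neg_cancel, Complex.exp_zero]
  rcases Int.eq_nat_or_neg m with ⟨n, rfl | rfl⟩
  · have e1 : Complex.exp (Complex.I * ((n : ℤ) : ℂ) * θ) = Complex.exp (Complex.I * θ) ^ n := by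
      rw [← Complex.exp_nat_mul]; congr 1; push_cast; ring
    rw [e1]
    simp only [Int.toNat_natCast, Int.natAbs_natCast, Int.toNat_neg_natCast, add_zero]
    rw [div_mul_div_comm, jacobiAnger_monomial _ _ _ hE]
    push_cast
    ring
  · have e1 : Complex.exp (Complex.I * ((-(n : ℤ) : ℤ) : ℂ) * θ) =
        Complex.exp (-(Complex.I * θ)) ^ n := by
      rw [← Complex.exp_nat_mul]; congr 1; push_cast; ring
    rw [e1]
    simp only [neg_neg, Int.toNat_natCast, Int.natAbs_natCast, Int.natAbs_neg,
      Int.toNat_neg_natCast, add_zero]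
    rw [mul_comm, div_mul_div_comm, jacobiAnger_monomial _ _ _ ((mul_comm _ _).trans hE)]
    push_cast
    ring

/-- The Jacobi-Anger expansion. -/
theorem hasSum_jacobiAnger (t θ : ℝ) :
    HasSum (fun m : ℤ => Complex.I ^ m.natAbs * Complex.exp (Complex.I * m * θ) *
      (besselJ m.natAbs t : ℂ)) (Complex.exp (Complex.I * (t * Real.cos θ : ℝ))) := by
  have h := hasSum_diffMin
    (f := fun n => (Complex.I * t / 2 * Complex.exp (Complex.I * θ)) ^ n / n.factorial)
    (g := fun n => (Complex.I * t / 2 * Complex.exp (-(Complex.I * θ))) ^ n / n.factorial)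
    (summable_norm_pow_div_factorial _) (summable_norm_pow_div_factorial _)
    (hasSum_exp_pow_div_factorial _) (hasSum_exp_pow_div_factorial _)
  simp only [jacobiAnger_term] at h
  have h2 := h.prod_fiberwise (g := fun m : ℤ => Complex.I ^ m.natAbs *
    Complex.exp (Complex.I * m * θ) * (besselJ m.natAbs t : ℂ)) fun m =>
      (Complex.hasSum_ofReal.2 (summable_besselJ m.natAbs t).hasSum).mul_left
        (Complex.I ^ m.natAbs * Complex.exp (Complex.I * m * θ))
  rw [← Complex.exp_add] at h2
  have e : Complex.I * t / 2 * Complex.exp (Complex.I * θ) +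
      Complex.I * t / 2 * Complex.exp (-(Complex.I * θ)) = Complex.I * (t * Real.cos θ : ℝ) := by
    push_cast
    rw [Complex.cos, mul_comm (θ : ℂ), neg_mul, mul_comm (θ : ℂ)]
    ring
  rwa [e] at h2

/-- At angle 0 all phases in the Jacobi-Anger series have norm 1. This bound permits termwise
integration against Z. -/
theorem summable_abs_besselJ (t : ℝ) : Summable fun m : ℤ => |besselJ m.natAbs t| := by
  have := (hasSum_jacobiAnger t 0).summable.norm
  simpa using this

theorem hasSum_of_eq {ι : Type*} {f g : ι → ℂ} {a b : ℂ} (h : HasSum f a) (hfg : ∀ i, g i = f i)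
    (hab : b = a) : HasSum g b := by
  rw [hab, funext hfg]; exact h

/-! ### Polar expansions of Cartesian and parabolic waves -/

/-- The angular factor of the expansion of a Cartesian wave in polar waves. -/
noncomputable def angularFactor (s : WaveParity) (m : ℤ) (α : ℝ) : ℂ :=
  match s with
  | .even => (Real.cos (m * α) : ℝ)
  | .odd => -(Real.sin (m * α) : ℝ)

theorem continuous_angularFactor (s : WaveParity) (m : ℤ) : Continuous (angularFactor s m) := by
  cases s
  · show Continuous fun α : ℝ => ((Real.cos (m * α) : ℝ) : ℂ)
    fun_prop
  · show Continuous fun α : ℝ => -((Real.sin (m * α) : ℝ) : ℂ)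
    fun_prop

theorem norm_angularFactor_le (s : WaveParity) (m : ℤ) (α : ℝ) : ‖angularFactor s m α‖ ≤ 1 := by
  cases s
  · rw [angularFactor, Complex.norm_real]; exact Real.abs_cos_le_one _
  · rw [angularFactor, norm_neg, Complex.norm_real]; exact Real.abs_sin_le_one _

/-- A Cartesian wave is the half sum, or -i/2 times the difference, of plane waves in the directions
α and -α, each expanded by Jacobi-Anger. -/
theorem hasSum_cartesianWave (s : WaveParity) (k r φ : ℝ) {α : ℝ} (hα : 0 ≤ α) :
    HasSum (fun m : ℤ => (√k / (2 * Real.pi) : ℝ) * (Complex.I ^ m.natAbs *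
      Complex.exp (Complex.I * m * φ) * (besselJ m.natAbs (k * r) : ℂ)) * angularFactor s m α)
      (cartesianWave s k α (r * Real.cos φ) (r * Real.sin φ)) := by
  have h1 := hasSum_jacobiAnger (k * r) (φ - α)
  have h2 := hasSum_jacobiAnger (k * r) (φ + α)
  have e1 (m : ℤ) : Complex.exp (Complex.I * m * (φ - α : ℝ)) = Complex.exp (Complex.I * m * φ) *
      Complex.exp (-(m * α * Complex.I)) := by
    rw [← Complex.exp_add]; congr 1; push_cast; ring
  have e2 (m : ℤ) : Complex.exp (Complex.I * m * (φ + α : ℝ)) = Complex.exp (Complex.I * m * φ) *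
      Complex.exp (m * α * Complex.I) := by
    rw [← Complex.exp_add]; congr 1; push_cast; ring
  have e3 : Complex.exp (Complex.I * (k * r * Real.cos (φ - α) : ℝ)) =
      Complex.exp (Complex.I * (k * (r * Real.cos φ) * Real.cos α : ℝ)) *
        Complex.exp ((k * Real.sin α * (r * Real.sin φ) : ℝ) * Complex.I) := by
    rw [← Complex.exp_add, Real.cos_sub]; congr 1; push_cast; ring
  have e4 : Complex.exp (Complex.I * (k * r * Real.cos (φ + α) : ℝ)) =
      Complex.exp (Complex.I * (k * (r * Real.cos φ) * Real.cos α : ℝ)) *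
        Complex.exp (-((k * Real.sin α * (r * Real.sin φ) : ℝ)) * Complex.I) := by
    rw [← Complex.exp_add, Real.cos_add]; congr 1; push_cast; ring
  rw [e3] at h1
  rw [e4] at h2
  cases s
  · have h := ((h1.add h2).mul_left ((√k / (2 * Real.pi) : ℝ) / 2 : ℂ))
    refine hasSum_of_eq h (fun m => ?_) ?_
    · rw [e1, e2, angularFactor, Complex.ofReal_cos, Complex.cos, neg_mul]
      push_cast
      ring
    · rw [cartesianWave, abs_of_nonneg hα, Complex.ofReal_cos, Complex.cos]
      ring
  · have h := ((h1.sub h2).mul_left ((√k / (2 * Real.pi) : ℝ) * (-Complex.I) / 2 : ℂ))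
    refine hasSum_of_eq h (fun m => ?_) ?_
    · rw [e1, e2, angularFactor, Complex.ofReal_sin, Complex.sin, neg_mul]
      push_cast
      ring
    · rw [cartesianWave, abs_of_nonneg hα, Complex.ofReal_sin, Complex.sin]
      ring

/-- The coefficients of the expansion of a parabolic wave in polar waves. -/
noncomputable def parabolicPolarCoeff (s : WaveParity) (k β : ℝ) (m : ℤ) : ℂ :=
  (√(2 * Real.pi) / Real.pi : ℝ) * Complex.I ^ m.natAbs *
    ∫ α in (0 : ℝ)..Real.pi, kernelZ k β α * angularFactor s m α

/-- Termwise integration of the polar series of the Cartesian wave, dominated by |Z| times a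
summable sequence of Bessel values. -/
theorem isParabolicPolarExpansion_parabolicPolarCoeff (s : WaveParity) {k : ℝ} (hk : 0 < k)
    (β : ℝ) : IsParabolicPolarExpansion s k β (parabolicPolarCoeff s k β) := by
  intro ξ η r φ _ hr hx hy
  have hpi := Real.pi_pos
  rw [parabolicWave_eq_integral s hk, hx, hy]
  have hZ := intervalIntegrable_kernelZ hk β
  have hs := (summable_abs_besselJ (k * r)).mul_left (√k / (2 * Real.pi))
  have key := (intervalIntegral.hasSum_integral_of_dominated_convergence (μ := volume)
    (a := (0 : ℝ)) (b := Real.pi)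
    (F := fun (m : ℤ) (α : ℝ) => kernelZ k β α * ((√k / (2 * Real.pi) : ℝ) *
      (Complex.I ^ m.natAbs * Complex.exp (Complex.I * m * φ) *
        (besselJ m.natAbs (k * r) : ℂ)) * angularFactor s m α))
    (f := fun α => kernelZ k β α * cartesianWave s k α (r * Real.cos φ) (r * Real.sin φ))
    (fun m α => ‖kernelZ k β α‖ * (√k / (2 * Real.pi) * |besselJ m.natAbs (k * r)|))
    (fun m => ?_) (fun m => ?_) ?_ ?_ ?_).mul_left 2
  · refine hasSum_of_eq key (fun m => ?_) rfl
    have e (α : ℝ) : kernelZ k β α * ((√k / (2 * Real.pi) : ℝ) *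
      (Complex.I ^ m.natAbs * Complex.exp (Complex.I * m * φ) *
        (besselJ m.natAbs (k * r) : ℂ)) * angularFactor s m α) = (√k / (2 * Real.pi) : ℝ) *
      (Complex.I ^ m.natAbs * Complex.exp (Complex.I * m * φ) *
        (besselJ m.natAbs (k * r) : ℂ)) * (kernelZ k β α * angularFactor s m α) := by ring
    simp only [e]
    rw [intervalIntegral.integral_const_mul, parabolicPolarCoeff, polarWave]
    have h1 : (√(2 * Real.pi) : ℂ) ≠ 0 := by
      exact_mod_cast (Real.sqrt_pos.2 (by positivity)).ne'
    have h2 : (Real.pi : ℂ) ≠ 0 := by exact_mod_cast hpi.ne'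
    push_cast
    field_simp
  · rw [Set.uIoc_of_le hpi.le]
    exact hZ.1.aestronglyMeasurable.mul
      ((continuous_angularFactor s m).const_mul _).aestronglyMeasurable
  · refine Eventually.of_forall fun α _ => ?_
    rw [norm_mul, norm_mul, norm_mul, norm_mul, norm_mul, norm_pow, Complex.norm_I, one_pow,
      one_mul, show Complex.I * m * φ = ((m * φ : ℝ) : ℂ) * Complex.I by push_cast; ring,
      Complex.norm_exp_ofReal_mul_I, one_mul, Complex.norm_real, Complex.norm_real,
      Real.norm_of_nonneg (by positivity), Real.norm_eq_abs]
    exact mul_le_mul_of_nonneg_left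
      (mul_le_of_le_one_right (by positivity) (norm_angularFactor_le s m α)) (norm_nonneg _)
  · exact Eventually.of_forall fun α _ => hs.mul_left _
  · simp only [tsum_mul_left]
    exact hZ.norm.mul_const _
  · refine Eventually.of_forall fun α hα => ?_
    rw [Set.uIoc_of_le hpi.le] at hα
    exact (hasSum_cartesianWave s k r φ hα.1.le).mul_left _

/-! ### Uniqueness of the polar expansion -/

theorem integral_exp_int_mul (n : ℤ) :
    ∫ φ in (0 : ℝ)..2 * Real.pi, Complex.exp (Complex.I * n * φ) =
      if n = 0 then 2 * Real.pi else 0 := by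
  split_ifs with h
  · simp [h]
  · have hc : Complex.I * n ≠ 0 := mul_ne_zero Complex.I_ne_zero (by exact_mod_cast h)
    rw [integral_exp_mul_complex hc]
    have : Complex.I * n * (2 * Real.pi : ℝ) = n * (2 * Real.pi * Complex.I) := by
      push_cast; ring
    rw [this, Complex.exp_int_mul_two_pi_mul_I]
    simp

/-- A trigonometric series that sums to zero unconditionally everywhere has zero coefficients. -/
theorem eq_zero_of_hasSum_exp {c : ℤ → ℂ}
    (h : ∀ φ : ℝ, HasSum (fun m : ℤ => c m * Complex.exp (Complex.I * m * φ)) 0) (n : ℤ) :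
    c n = 0 := by
  have hc : Summable fun m => ‖c m‖ := by
    have := (h 0).summable.norm
    simpa using this
  -- Integrating against exp(-inφ) isolates c n; convergence at φ = 0 provides the dominating
  -- series.
  have key := intervalIntegral.hasSum_integral_of_dominated_convergence (μ := volume)
    (a := (0 : ℝ)) (b := 2 * Real.pi)
    (F := fun (m : ℤ) (φ : ℝ) => c m * Complex.exp (Complex.I * m * φ) *
      Complex.exp (Complex.I * (-n : ℤ) * φ))
    (f := fun _ => 0) (fun m _ => ‖c m‖)
    (fun m => by fun_prop) (fun m => Eventually.of_forall fun φ _ => by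
      rw [norm_mul, norm_mul,
        show Complex.I * m * φ = ((m * φ : ℝ) : ℂ) * Complex.I by push_cast; ring,
        show Complex.I * (-n : ℤ) * φ = (((-n : ℤ) * φ : ℝ) : ℂ) * Complex.I by push_cast; ring,
        Complex.norm_exp_ofReal_mul_I, Complex.norm_exp_ofReal_mul_I, mul_one, mul_one])
    (Eventually.of_forall fun _ _ => hc) (by simp)
    (Eventually.of_forall fun φ _ => by simpa using (h φ).mul_right _)
  have e (m : ℤ) : ∫ φ in (0 : ℝ)..2 * Real.pi, c m * Complex.exp (Complex.I * m * φ) *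
      Complex.exp (Complex.I * (-n : ℤ) * φ) = if m = n then c n * (2 * Real.pi) else 0 := by
    have : (fun φ : ℝ => c m * Complex.exp (Complex.I * m * φ) *
        Complex.exp (Complex.I * (-n : ℤ) * φ)) =
        fun φ : ℝ => c m * Complex.exp (Complex.I * (m - n : ℤ) * φ) := by
      funext φ
      rw [mul_assoc, ← Complex.exp_add]
      congr 2
      push_cast
      ring
    rw [this, intervalIntegral.integral_const_mul, integral_exp_int_mul]
    rcases eq_or_ne m n with rfl | hmn
    · simp
    · simp [hmn, sub_ne_zero.2 hmn]
  simp only [e, intervalIntegral.integral_zero] at key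
  have h0 := key.unique (hasSum_ite_eq n _)
  have hpi : (Real.pi : ℂ) ≠ 0 := by exact_mod_cast Real.pi_ne_zero
  simpa [hpi] using h0.symm

/-- ξ + iη is a square root of 2(x + iy), that is ±√(2r) exp(iφ/2), with the sign chosen so that ξ ≥
0. -/
theorem exists_parabolic_coordinates {r : ℝ} (hr : 0 < r) (φ : ℝ) :
    ∃ ξ η : ℝ, 0 ≤ ξ ∧ (ξ ^ 2 - η ^ 2) / 2 = r * Real.cos φ ∧ ξ * η = r * Real.sin φ := by
  have h : √(2 * r) ^ 2 = 2 * r := Real.sq_sqrt (by positivity)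
  have hc : Real.cos φ = Real.cos (φ / 2) ^ 2 - Real.sin (φ / 2) ^ 2 := by
    conv_lhs => rw [← mul_div_cancel₀ φ (two_ne_zero (α := ℝ)), Real.cos_two_mul']
  have hs := sin_eq_two_mul_half φ
  rcases le_total 0 (Real.cos (φ / 2)) with h0 | h0
  · refine ⟨√(2 * r) * Real.cos (φ / 2), √(2 * r) * Real.sin (φ / 2), by positivity, ?_, ?_⟩
    · rw [hc]; linear_combination ((Real.cos (φ / 2) ^ 2 - Real.sin (φ / 2) ^ 2) / 2) * h
    · rw [hs]; linear_combination (Real.cos (φ / 2) * Real.sin (φ / 2)) * h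
  · refine ⟨-(√(2 * r) * Real.cos (φ / 2)), -(√(2 * r) * Real.sin (φ / 2)),
      neg_nonneg.2 (mul_nonpos_of_nonneg_of_nonpos (Real.sqrt_nonneg _) h0), ?_, ?_⟩
    · rw [hc]; linear_combination ((Real.cos (φ / 2) ^ 2 - Real.sin (φ / 2) ^ 2) / 2) * h
    · rw [hs]; linear_combination (Real.cos (φ / 2) * Real.sin (φ / 2)) * h

/-- On the circle r = 1/k the difference of two expansions is a vanishing trigonometric series, and
its Bessel factors at 1 are nonzero. -/
theorem IsParabolicPolarExpansion.unique {s : WaveParity} {k β : ℝ} (hk : 0 < k) {W W' : ℤ → ℂ}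
    (hW : IsParabolicPolarExpansion s k β W) (hW' : IsParabolicPolarExpansion s k β W') :
    W' = W := by
  funext n
  have hr : 0 < 1 / k := by positivity
  have h := eq_zero_of_hasSum_exp
    (c := fun m => (W' m - W m) * ((√k * besselJ m.natAbs 1 : ℝ) / (√(2 * Real.pi) : ℝ)))
    (fun φ => by
      obtain ⟨ξ, η, h0, hx, hy⟩ := exists_parabolic_coordinates hr φ
      have := (hW' ξ η _ φ h0 hr hx hy).sub (hW ξ η _ φ h0 hr hx hy)
      rw [sub_self] at this
      refine hasSum_of_eq this (fun m => ?_) rfl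
      rw [polarWave, mul_one_div_cancel hk.ne']
      ring) n
  have h1 : ((√k * besselJ n.natAbs 1 : ℝ) : ℂ) / (√(2 * Real.pi) : ℝ) ≠ 0 := by
    have h2 : √k * besselJ n.natAbs 1 ≠ 0 :=
      mul_ne_zero (Real.sqrt_pos.2 hk).ne' (besselJ_one_ne_zero _)
    have h3 : √(2 * Real.pi) ≠ 0 := (Real.sqrt_pos.2 (by have := Real.pi_pos; positivity)).ne'
    exact div_ne_zero (by exact_mod_cast h2) (by exact_mod_cast h3)
  exact sub_eq_zero.1 ((mul_eq_zero.1 h).resolve_right h1)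

/-! ### Pointwise convergence of the Fourier series of the kernel -/

/-- The Dirichlet kernel. -/
noncomputable def dirichletSum (N : ℕ) (x : ℝ) : ℂ :=
  ∑ m ∈ Finset.Icc (-(N : ℤ)) (N : ℤ), Complex.exp (Complex.I * m * x)

theorem continuous_dirichletSum (N : ℕ) : Continuous (dirichletSum N) := by
  unfold dirichletSum; fun_prop

theorem sum_Icc_neg_succ (f : ℤ → ℂ) (N : ℕ) :
    ∑ m ∈ Finset.Icc (-((N + 1 : ℕ) : ℤ)) ((N + 1 : ℕ) : ℤ), f m =
      ∑ m ∈ Finset.Icc (-(N : ℤ)) (N : ℤ), f m + f (N + 1) + f (-(N + 1)) := by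
  have e : Finset.Icc (-((N + 1 : ℕ) : ℤ)) ((N + 1 : ℕ) : ℤ) =
      insert (-((N : ℤ) + 1)) (insert ((N : ℤ) + 1) (Finset.Icc (-(N : ℤ)) (N : ℤ))) := by
    ext m
    simp only [Finset.mem_insert, Finset.mem_Icc]
    omega
  rw [e, Finset.sum_insert (by simp only [Finset.mem_insert, Finset.mem_Icc]; omega),
    Finset.sum_insert (by simp only [Finset.mem_Icc]; omega)]
  ring

theorem exp_sub_one_mul_dirichletSum (N : ℕ) (x : ℝ) :
    (Complex.exp (Complex.I * x) - 1) * dirichletSum N x =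
      Complex.exp (Complex.I * (N + 1 : ℕ) * x) - Complex.exp (-(Complex.I * N * x)) := by
  induction N with
  | zero => simp [dirichletSum]
  | succ N ih =>
    rw [dirichletSum, sum_Icc_neg_succ, ← dirichletSum, mul_add, mul_add, ih, sub_mul, sub_mul,
      ← Complex.exp_add, ← Complex.exp_add, one_mul, one_mul]
    have e1 : Complex.I * x + Complex.I * ((N + 1 : ℤ) : ℂ) * x =
        Complex.I * ((N + 1 + 1 : ℕ) : ℂ) * x := by push_cast; ring
    have e2 : Complex.I * x + Complex.I * ((-(N + 1) : ℤ) : ℂ) * x = -(Complex.I * N * x) := by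
      push_cast; ring
    have e3 : Complex.I * ((-(N + 1) : ℤ) : ℂ) * x = -(Complex.I * ((N + 1 : ℕ) : ℂ) * x) := by
      push_cast; ring
    have e4 : Complex.I * ((N + 1 : ℤ) : ℂ) * x = Complex.I * ((N + 1 : ℕ) : ℂ) * x := by
      push_cast; ring
    rw [e1, e2, e3, e4]
    ring

theorem sum_cos_eq_dirichletSum (N : ℕ) (x : ℝ) :
    ∑ m ∈ Finset.Icc (-(N : ℤ)) (N : ℤ), ((Real.cos (m * x) : ℝ) : ℂ) = dirichletSum N x := by
  have h : dirichletSum N x =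
      ∑ m ∈ Finset.Icc (-(N : ℤ)) (N : ℤ), Complex.exp (-(Complex.I * m * x)) := by
    refine Finset.sum_equiv (Equiv.neg ℤ) (fun m => ?_) fun m _ => ?_
    · simp only [Finset.mem_Icc, Equiv.neg_apply]; omega
    · simp
  have h2 : dirichletSum N x = (dirichletSum N x + dirichletSum N x) / 2 := by ring
  rw [h2]
  nth_rw 2 [h]
  rw [dirichletSum, ← Finset.sum_add_distrib, Finset.sum_div]
  refine Finset.sum_congr rfl fun m _ => ?_
  rw [Complex.ofReal_cos, Complex.cos]
  push_cast
  ring_nf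

/-- The Riemann-Lebesgue lemma on `(0, π)`. -/
theorem tendsto_integral_exp_mul (g : ℝ → ℂ) {w : ℕ → ℝ}
    (hw : Tendsto (fun n => ‖w n‖) atTop atTop) :
    Tendsto (fun n => ∫ α in (0 : ℝ)..Real.pi, Complex.exp (Complex.I * w n * α) * g α)
      atTop (𝓝 0) := by
  have hpi := Real.pi_pos
  have h := Real.tendsto_integral_exp_smul_cocompact ((Set.Ioc 0 Real.pi).indicator g)
  have hc : Tendsto (fun n => -(w n) / (2 * Real.pi)) atTop (cocompact ℝ) := by
    rw [← Metric.cobounded_eq_cocompact, ← tendsto_norm_atTop_iff_cobounded]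
    simp only [norm_div, norm_neg]
    exact hw.atTop_div_const (by rw [Real.norm_of_nonneg (by positivity)]; positivity)
  refine (h.comp hc).congr fun n => ?_
  rw [intervalIntegral.integral_of_le hpi.le, ← integral_indicator measurableSet_Ioc]
  simp only [Function.comp]
  congr 1 with α
  by_cases hα : α ∈ Set.Ioc 0 Real.pi
  · rw [Set.indicator_of_mem hα, Set.indicator_of_mem hα, Circle.smul_def, Real.fourierChar_apply,
      smul_eq_mul]
    congr 2
    have : (Real.pi : ℂ) ≠ 0 := by exact_mod_cast hpi.ne'
    push_cast
    field_simp
  · rw [Set.indicator_of_notMem hα, Set.indicator_of_notMem hα, smul_zero]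

theorem intervalIntegrable_exp_mul {g : ℝ → ℂ} (hg : IntervalIntegrable g volume 0 Real.pi)
    (w : ℝ) :
    IntervalIntegrable (fun α : ℝ => Complex.exp (Complex.I * w * α) * g α) volume 0 Real.pi :=
  hg.continuousOn_mul (by fun_prop)

/-- Multiplied by exp(ix) - 1, the Dirichlet kernel is a difference of two pure exponentials; with
an integrable quotient g, Riemann-Lebesgue applies to both. -/
theorem tendsto_integral_mul_dirichletSum {g h : ℝ → ℂ} {c : ℝ}
    (hg : IntervalIntegrable g volume 0 Real.pi)
    (hh : ∀ α ∈ Set.Icc 0 Real.pi, h α = (Complex.exp (Complex.I * (α + c : ℝ)) - 1) * g α) :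
    Tendsto (fun N : ℕ => ∫ α in (0 : ℝ)..Real.pi, h α * dirichletSum N (α + c)) atTop (𝓝 0) := by
  have hN : Tendsto (fun n : ℕ => ‖(n : ℝ)‖) atTop atTop := by
    simpa using tendsto_natCast_atTop_atTop (R := ℝ)
  have h1 := (tendsto_integral_exp_mul g (w := fun n : ℕ => ((n + 1 : ℕ) : ℝ))
    (hN.comp (tendsto_add_atTop_nat 1))).norm
  have h2 := (tendsto_integral_exp_mul g (w := fun n : ℕ => -(n : ℝ)) (by simpa using hN)).norm
  have h3 := h1.add h2
  rw [norm_zero, add_zero] at h3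
  refine squeeze_zero_norm (fun N => ?_) h3
  have e : ∫ α in (0 : ℝ)..Real.pi, h α * dirichletSum N (α + c) =
      Complex.exp (((N + 1 : ℕ) * c : ℝ) * Complex.I) *
        (∫ α in (0 : ℝ)..Real.pi, Complex.exp (Complex.I * ((N + 1 : ℕ) : ℝ) * α) * g α) -
      Complex.exp ((-(N * c) : ℝ) * Complex.I) *
        ∫ α in (0 : ℝ)..Real.pi, Complex.exp (Complex.I * (-(N : ℝ) : ℝ) * α) * g α := by
    rw [← intervalIntegral.integral_const_mul, ← intervalIntegral.integral_const_mul,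
      ← intervalIntegral.integral_sub ((intervalIntegrable_exp_mul hg _).const_mul _)
        ((intervalIntegrable_exp_mul hg _).const_mul _)]
    refine intervalIntegral.integral_congr fun α hα => ?_
    rw [Set.uIcc_of_le Real.pi_pos.le] at hα
    rw [hh α hα, mul_right_comm, exp_sub_one_mul_dirichletSum, ← mul_assoc, ← mul_assoc,
      ← Complex.exp_add, ← Complex.exp_add, sub_mul]
    congr 3 <;> · push_cast; ring
  rw [e]
  refine (norm_sub_le _ _).trans (le_of_eq ?_)
  rw [norm_mul, norm_mul, Complex.norm_exp_ofReal_mul_I, Complex.norm_exp_ofReal_mul_I, one_mul,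
    one_mul]

theorem exp_I_mul_ne_one {x : ℝ} (h0 : x ≠ 0) (h : |x| < 2 * Real.pi) :
    Complex.exp (Complex.I * x) ≠ 1 := by
  intro he
  obtain ⟨n, hn⟩ := Complex.exp_eq_one_iff.1 he
  have h1 : x = n * (2 * Real.pi) := by
    have := congrArg Complex.im hn
    simpa [mul_assoc] using this
  have hpi := Real.pi_pos
  rcases eq_or_ne n 0 with rfl | hn0
  · simp at h1; exact h0 h1
  · have h2 : (1 : ℝ) ≤ |(n : ℝ)| := by exact_mod_cast Int.one_le_abs hn0
    rw [h1, abs_mul, abs_of_pos (by positivity : 0 < 2 * Real.pi)] at h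
    nlinarith

theorem differentiableAt_kernelZ {k : ℝ} (hk : 0 < k) (β : ℝ) {α : ℝ}
    (hα : α ∈ Set.Ioo 0 Real.pi) : DifferentiableAt ℝ (kernelZ k β) α := by
  have hs := Real.sin_pos_of_mem_Ioo hα
  have hc2 := cos_half_pos hα
  have hs2 := sin_half_pos hα
  have hpi := Real.pi_pos
  have e : kernelZ k β =ᶠ[𝓝 α] fun α => Complex.exp (((Real.log (Real.cos (α / 2) /
      Real.sin (α / 2)) : ℝ) : ℂ) * (Complex.I * β / k)) *
        ((2 * √(Real.pi * k * Real.sin α))⁻¹ : ℝ) := by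
    filter_upwards [isOpen_Ioo.mem_nhds hα] with a ha
    have hd := div_pos (cos_half_pos ha) (sin_half_pos ha)
    rw [kernelZ, abs_of_pos ha.1, Real.cot_eq_cos_div_sin,
      Complex.cpow_def_of_ne_zero (by exact_mod_cast hd.ne'), ← Complex.ofReal_log hd.le,
      Complex.ofReal_inv, div_eq_mul_inv]
  refine DifferentiableAt.congr_of_eventuallyEq ?_ e
  have h1 : DifferentiableAt ℝ (fun α : ℝ => Real.log (Real.cos (α / 2) / Real.sin (α / 2))) α :=
    DifferentiableAt.log (DifferentiableAt.div (by fun_prop) (by fun_prop) hs2.ne')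
      (div_pos hc2 hs2).ne'
  have h2 : DifferentiableAt ℝ (fun α : ℝ => (2 * √(Real.pi * k * Real.sin α))⁻¹) α :=
    DifferentiableAt.inv ((DifferentiableAt.sqrt (by fun_prop) (by positivity)).const_mul 2)
      (by positivity)
  have h1' := Complex.ofRealCLM.differentiableAt.comp α h1
  have h2' := Complex.ofRealCLM.differentiableAt.comp α h2
  exact (h1'.mul_const _).cexp.mul h2'

/-- The difference quotient of the kernel against `exp (i (α - α₀))` is integrable. -/
theorem exists_intervalIntegrable_quotient {Z : ℝ → ℂ} (hZ : IntervalIntegrable Z volume 0 Real.pi)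
    (hd : ∀ α ∈ Set.Ioo 0 Real.pi, DifferentiableAt ℝ Z α) {α₀ : ℝ} (h₀ : α₀ ∈ Set.Ioo 0 Real.pi) :
    ∃ g : ℝ → ℂ, IntervalIntegrable g volume 0 Real.pi ∧ ∀ α ∈ Set.Icc 0 Real.pi,
      Z α - Z α₀ = (Complex.exp (Complex.I * (α + -α₀ : ℝ)) - 1) * g α := by
  set E : ℝ → ℂ := fun α => Complex.exp (Complex.I * (α + -α₀ : ℝ)) with hE
  have hE0 : E α₀ = 1 := by simp [hE]
  have hEc : Continuous E := by fun_prop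
  have hEd : HasDerivAt E Complex.I α₀ := by
    have h1 : HasDerivAt (fun α : ℝ => Complex.I * ((α + -α₀ : ℝ) : ℂ)) (Complex.I * 1) α₀ :=
      (((hasDerivAt_id α₀).add_const (-α₀)).ofReal_comp.const_mul Complex.I)
    have h2 := h1.cexp
    simpa [hE] using h2
  have hne {α : ℝ} (hα : α ∈ Set.Icc 0 Real.pi) (h : α ≠ α₀) : E α - 1 ≠ 0 := by
    refine sub_ne_zero.2 (exp_I_mul_ne_one (fun h' => h (by linarith)) ?_)
    rw [abs_lt]
    constructor <;> linarith [hα.1, hα.2, h₀.1, h₀.2, Real.pi_pos]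
  have hq {α : ℝ} (h : α ≠ α₀) : dslope Z α₀ α / dslope E α₀ α = (Z α - Z α₀) * (E α - 1)⁻¹ := by
    have h3 : ((α - α₀ : ℝ) : ℂ) ≠ 0 := by exact_mod_cast sub_ne_zero.2 h
    rw [dslope_of_ne _ h, dslope_of_ne _ h, slope_def_module, slope_def_module, hE0,
      Complex.real_smul, Complex.real_smul, Complex.ofReal_inv,
      mul_div_mul_left _ _ (inv_ne_zero h3), div_eq_mul_inv]
  -- A ratio of slopes is continuous across α₀, because E has derivative i ≠ 0 there. Away from α₀
  -- the denominator E - 1 is nonzero, so only the integrability of Z matters near the endpoints.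
  refine ⟨fun α => dslope Z α₀ α / dslope E α₀ α, ?_, fun α hα => ?_⟩
  · obtain ⟨a, ha0, ha⟩ := exists_between h₀.1
    obtain ⟨b, hb, hbp⟩ := exists_between h₀.2
    have hside {c d : ℝ} (hcd : c ≤ d) (hsub : Set.Icc c d ⊆ Set.Icc 0 Real.pi)
        (hn : α₀ ∉ Set.Icc c d) :
        IntervalIntegrable (fun α => dslope Z α₀ α / dslope E α₀ α) volume c d := by
      have hZ' : IntervalIntegrable Z volume c d :=
        hZ.mono_set (by rwa [Set.uIcc_of_le hcd, Set.uIcc_of_le Real.pi_pos.le])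
      have h4 : ContinuousOn (fun α => (E α - 1)⁻¹) (Set.uIcc c d) := by
        rw [Set.uIcc_of_le hcd]
        exact ContinuousOn.inv₀ (by fun_prop) fun α hα => hne (hsub hα) fun h => hn (h ▸ hα)
      refine ((hZ'.sub (intervalIntegrable_const (c := Z α₀))).mul_continuousOn h4).congr ?_
      intro α hα
      rw [Set.uIoc_of_le hcd] at hα
      exact (hq fun h => hn (h ▸ ⟨hα.1.le, hα.2⟩)).symm
    have hmid : IntervalIntegrable (fun α => dslope Z α₀ α / dslope E α₀ α) volume a b := by
      have hn : Set.Icc a b ∈ 𝓝 α₀ := Icc_mem_nhds ha hb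
      refine ContinuousOn.intervalIntegrable ?_
      rw [Set.uIcc_of_le (ha.trans hb).le]
      refine ContinuousOn.div ?_ ?_ fun α hα => ?_
      · exact (continuousOn_dslope hn).2 ⟨fun α hα => (hd α ⟨by linarith [hα.1], by
          linarith [hα.2]⟩).continuousAt.continuousWithinAt, hd α₀ h₀⟩
      · exact (continuousOn_dslope hn).2 ⟨hEc.continuousOn, hEd.differentiableAt⟩
      · rcases eq_or_ne α α₀ with rfl | h
        · rw [dslope_same, hEd.deriv]; exact Complex.I_ne_zero
        · rw [dslope_of_ne _ h, slope_def_module, hE0]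
          refine smul_ne_zero (inv_ne_zero (sub_ne_zero.2 h)) (hne ⟨?_, ?_⟩ h) <;>
            linarith [hα.1, hα.2]
    refine ((hside ha0.le ?_ ?_).trans hmid).trans (hside hbp.le ?_ ?_)
    · exact Set.Icc_subset_Icc_right (by linarith)
    · exact fun h => by linarith [h.2]
    · exact Set.Icc_subset_Icc_left (by linarith)
    · exact fun h => by linarith [h.1]
  · rcases eq_or_ne α α₀ with rfl | h
    · simp
    · simp only
      rw [hq h, mul_comm, inv_mul_cancel_right₀ (hne hα h)]

/-- The sign of the reflected term in the product of two angular factors. -/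
def reflectionSign (s : WaveParity) : ℂ :=
  match s with
  | .even => 1
  | .odd => -1

theorem angularFactor_mul (s : WaveParity) (m : ℤ) (a b : ℝ) :
    angularFactor s m a * angularFactor s m b =
      (((Real.cos (m * (b + -a)) : ℝ) : ℂ) +
        reflectionSign s * ((Real.cos (m * (b + a)) : ℝ) : ℂ)) / 2 := by
  rw [mul_add, mul_add, Real.cos_add, Real.cos_add, mul_neg, Real.cos_neg, Real.sin_neg]
  cases s <;> simp only [angularFactor, reflectionSign] <;> push_cast <;> ring

theorem sum_angularFactor_mul (s : WaveParity) (N : ℕ) (a b : ℝ) :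
    ∑ m ∈ Finset.Icc (-(N : ℤ)) (N : ℤ), angularFactor s m a * angularFactor s m b =
      (dirichletSum N (b + -a) + reflectionSign s * dirichletSum N (b + a)) / 2 := by
  simp only [angularFactor_mul]
  rw [← Finset.sum_div, Finset.sum_add_distrib, ← Finset.mul_sum, sum_cos_eq_dirichletSum,
    sum_cos_eq_dirichletSum]

theorem integral_angularFactor_even (m : ℤ) :
    ∫ α in (0 : ℝ)..Real.pi, angularFactor .even m α = if m = 0 then (Real.pi : ℂ) else 0 := by
  simp only [angularFactor]
  rw [intervalIntegral.integral_ofReal]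
  split_ifs with h
  · simp [h]
  · have hm : (m : ℝ) ≠ 0 := by exact_mod_cast h
    rw [intervalIntegral.integral_comp_mul_left (fun x => Real.cos x) hm, integral_cos,
      Real.sin_int_mul_pi]
    simp

/-- The two shifts together form a cosine kernel, of which only m = 0 survives on (0, π). A single
shift has no such exact mass on the half interval. -/
theorem integral_dirichletSum_add (N : ℕ) (a : ℝ) :
    ∫ α in (0 : ℝ)..Real.pi, (dirichletSum N (α + -a) + dirichletSum N (α + a)) =
      2 * Real.pi := by
  have e (α : ℝ) : dirichletSum N (α + -a) + dirichletSum N (α + a) =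
      ∑ m ∈ Finset.Icc (-(N : ℤ)) (N : ℤ),
        2 * angularFactor .even m a * angularFactor .even m α := by
    have := sum_angularFactor_mul .even N a α
    simp only [reflectionSign, one_mul] at this
    simp only [mul_assoc]
    rw [← Finset.mul_sum, this]
    ring
  simp only [e]
  rw [intervalIntegral.integral_finsetSum fun m _ =>
    ((continuous_angularFactor .even m).const_mul _).intervalIntegrable _ _]
  simp only [intervalIntegral.integral_const_mul, integral_angularFactor_even]
  rw [Finset.sum_eq_single (0 : ℤ)]
  · simp [angularFactor]
  · intro m _ hm; simp [hm]
  · intro h; simp at h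

/-- Product-to-sum formulas turn the partial sum into a Dirichlet kernel at α - α₀ and a reflected
one at α + α₀. The reflected one tends to 0; after subtracting Z(α₀) the direct one does too, and
the subtracted part contributes half of 2π Z(α₀). -/
theorem tendsto_sum_angularFactor (s : WaveParity) {Z : ℝ → ℂ}
    (hZ : IntervalIntegrable Z volume 0 Real.pi)
    (hd : ∀ α ∈ Set.Ioo 0 Real.pi, DifferentiableAt ℝ Z α) {α₀ : ℝ} (h₀ : α₀ ∈ Set.Ioo 0 Real.pi) :
    Tendsto (fun N : ℕ => ∑ m ∈ Finset.Icc (-(N : ℤ)) (N : ℤ),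
      angularFactor s m α₀ * ∫ α in (0 : ℝ)..Real.pi, Z α * angularFactor s m α)
      atTop (𝓝 (Real.pi * Z α₀)) := by
  have hpi := Real.pi_pos
  -- For α in [0, π] the argument α + α₀ stays strictly between 0 and 2π, so exp(i(α + α₀)) - 1
  -- never vanishes.
  have hrefl {h : ℝ → ℂ} (hh : IntervalIntegrable h volume 0 Real.pi) :
      Tendsto (fun N : ℕ => ∫ α in (0 : ℝ)..Real.pi, h α * dirichletSum N (α + α₀))
        atTop (𝓝 0) := by
    have hne (α : ℝ) (hα : α ∈ Set.Icc 0 Real.pi) :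
        Complex.exp (Complex.I * (α + α₀ : ℝ)) - 1 ≠ 0 := by
      refine sub_ne_zero.2 (exp_I_mul_ne_one (by linarith [hα.1, h₀.1]) ?_)
      rw [abs_lt]
      constructor <;> linarith [hα.1, hα.2, h₀.1, h₀.2]
    refine tendsto_integral_mul_dirichletSum
      (g := fun α => h α * (Complex.exp (Complex.I * (α + α₀ : ℝ)) - 1)⁻¹)
      (hh.mul_continuousOn ?_) fun α hα => ?_
    · rw [Set.uIcc_of_le hpi.le]
      exact ContinuousOn.inv₀ (by fun_prop) hne
    · rw [mul_comm, inv_mul_cancel_right₀ (hne α hα)]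
  obtain ⟨g, hg, hgZ⟩ := exists_intervalIntegrable_quotient hZ hd h₀
  have t1 := tendsto_integral_mul_dirichletSum hg hgZ
  have t2 := hrefl hZ
  have t3 := hrefl (h := fun _ => 1) intervalIntegrable_const
  have hD (N : ℕ) (c : ℝ) : Continuous fun α => dirichletSum N (α + c) :=
    (continuous_dirichletSum N).comp (continuous_add_const c)
  have hDi (N : ℕ) (c : ℝ) : IntervalIntegrable (fun α => dirichletSum N (α + c))
      volume 0 Real.pi := (hD N c).intervalIntegrable _ _
  have hZD (N : ℕ) (c : ℝ) : IntervalIntegrable (fun α => Z α * dirichletSum N (α + c))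
      volume 0 Real.pi := hZ.mul_continuousOn (hD N c).continuousOn
  have e (N : ℕ) : ∑ m ∈ Finset.Icc (-(N : ℤ)) (N : ℤ),
      angularFactor s m α₀ * ∫ α in (0 : ℝ)..Real.pi, Z α * angularFactor s m α =
      ((∫ α in (0 : ℝ)..Real.pi, (Z α - Z α₀) * dirichletSum N (α + -α₀)) +
        Z α₀ * (2 * Real.pi - ∫ α in (0 : ℝ)..Real.pi, 1 * dirichletSum N (α + α₀)) +
        reflectionSign s * ∫ α in (0 : ℝ)..Real.pi, Z α * dirichletSum N (α + α₀)) / 2 := by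
    have e1 : ∫ α in (0 : ℝ)..Real.pi, (Z α - Z α₀) * dirichletSum N (α + -α₀) =
        (∫ α in (0 : ℝ)..Real.pi, Z α * dirichletSum N (α + -α₀)) -
          Z α₀ * ∫ α in (0 : ℝ)..Real.pi, dirichletSum N (α + -α₀) := by
      rw [← intervalIntegral.integral_const_mul,
        ← intervalIntegral.integral_sub (hZD N _) ((hDi N _).const_mul _)]
      simp only [sub_mul]
    have e2 := integral_dirichletSum_add N α₀
    rw [intervalIntegral.integral_add (hDi N _) (hDi N _)] at e2
    have e3 : ∑ m ∈ Finset.Icc (-(N : ℤ)) (N : ℤ),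
        angularFactor s m α₀ * ∫ α in (0 : ℝ)..Real.pi, Z α * angularFactor s m α =
        ∫ α in (0 : ℝ)..Real.pi, (Z α * dirichletSum N (α + -α₀) +
          reflectionSign s * (Z α * dirichletSum N (α + α₀))) / 2 := by
      simp only [← intervalIntegral.integral_const_mul]
      rw [← intervalIntegral.integral_finsetSum fun m _ =>
        ((hZ.mul_continuousOn (continuous_angularFactor s m).continuousOn).const_mul _)]
      congr 1 with α
      have := sum_angularFactor_mul s N α₀ α
      calc _ = Z α * ∑ m ∈ Finset.Icc (-(N : ℤ)) (N : ℤ),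
            angularFactor s m α₀ * angularFactor s m α := by
            rw [Finset.mul_sum]
            exact Finset.sum_congr rfl fun m _ => by ring
        _ = _ := by rw [this]; ring
    rw [e3, intervalIntegral.integral_div, intervalIntegral.integral_add (hZD N _)
      ((hZD N _).const_mul _), intervalIntegral.integral_const_mul, e1]
    simp only [one_mul]
    linear_combination (Z α₀ / 2) * e2
  simp only [e]
  have t := ((t1.add ((t3.const_sub (2 * Real.pi : ℂ)).const_mul (Z α₀))).add
    (t2.const_mul (reflectionSign s))).div_const 2
  convert t using 2
  ring

/-- The factor sign(sin α) converts sin(mα) into sin(m|α|), so both parities depend on |α| only. -/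
theorem polarCartesianCoeff_eq (s : WaveParity) (m : ℤ) {α : ℝ} (h0 : 0 < |α|)
    (hp : |α| < Real.pi) :
    polarCartesianCoeff s m α =
      (-Complex.I) ^ m.natAbs / (√(2 * Real.pi) : ℝ) * angularFactor s m |α| := by
  cases s
  · rcases abs_choice α with h | h <;> rw [polarCartesianCoeff, angularFactor, h]
    rw [mul_neg, Real.cos_neg]
  · rcases abs_cases α with ⟨h, h1⟩ | ⟨h, h1⟩
    · rw [h] at h0 hp
      rw [polarCartesianCoeff, angularFactor, h,
        Real.sign_of_pos (Real.sin_pos_of_pos_of_lt_pi h0 hp)]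
      push_cast
      ring
    · rw [h] at h0 hp
      have hs : Real.sin α < 0 := by
        have := Real.sin_pos_of_pos_of_lt_pi h0 hp
        rw [Real.sin_neg] at this
        linarith
      rw [polarCartesianCoeff, angularFactor, h, Real.sign_of_neg hs,
        show (m : ℝ) * -α = -(m * α) by ring, Real.sin_neg]
      push_cast
      ring

/-- The phases i^|m| and (-i)^|m| cancel and the normalizations leave 1/π, so the sum is the
trigonometric series of Z at |α|. -/
theorem tendsto_sum_parabolicPolarCoeff_mul (s : WaveParity) {k : ℝ} (hk : 0 < k) (β : ℝ) {α : ℝ}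
    (h0 : 0 < |α|) (hp : |α| < Real.pi) :
    Tendsto (fun N : ℕ => ∑ m ∈ Finset.Icc (-(N : ℤ)) (N : ℤ),
      parabolicPolarCoeff s k β m * polarCartesianCoeff s m α) atTop (𝓝 (kernelZ k β α)) := by
  have hpi := Real.pi_pos
  have h := (tendsto_sum_angularFactor s (intervalIntegrable_kernelZ hk β)
    (fun α hα => differentiableAt_kernelZ hk β hα) ⟨h0, hp⟩).const_mul ((Real.pi : ℂ)⁻¹)
  have hpi' : (Real.pi : ℂ) ≠ 0 := by exact_mod_cast hpi.ne'
  have hsq : (√(2 * Real.pi) : ℂ) ≠ 0 := by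
    exact_mod_cast (Real.sqrt_pos.2 (by positivity)).ne'
  rw [inv_mul_cancel_left₀ hpi', kernelZ_abs] at h
  refine h.congr fun N => ?_
  rw [Finset.mul_sum]
  refine Finset.sum_congr rfl fun m _ => ?_
  rw [polarCartesianCoeff_eq s m h0 hp, parabolicPolarCoeff]
  have hI : Complex.I ^ m.natAbs * (-Complex.I) ^ m.natAbs = 1 := by
    rw [← mul_pow, mul_neg, Complex.I_mul_I, neg_neg, one_pow]
  have e : ((√(2 * Real.pi) / Real.pi : ℝ) : ℂ) * (√(2 * Real.pi) : ℂ)⁻¹ = (Real.pi : ℂ)⁻¹ := by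
    push_cast
    field_simp
  have alg (c d p q T X P : ℂ) (hpq : p * q = 1) (hcd : c * d⁻¹ = P) :
      P * (T * X) = c * p * X * (q / d * T) := by
    rw [← hcd, div_eq_mul_inv]
    linear_combination (-(c * d⁻¹ * T * X)) * hpq
  exact alg _ _ _ _ _ _ _ hI e

end HelmholtzPlane

theorem mainTheorem6 (k : ℝ) (hk : 0 < k) :
    -- the coefficients `∑ W S`, for both parities, are given by one closed form
    (∀ (s : WaveParity) (β : ℝ), ∃ W : ℤ → ℂ,
      IsParabolicPolarExpansion s k β W ∧
      (∀ W' : ℤ → ℂ, IsParabolicPolarExpansion s k β W' → W' = W) ∧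
      ∀ α : ℝ, 0 < |α| → |α| < Real.pi →
        Tendsto (fun N : ℕ =>
            ∑ m ∈ Finset.Icc (-(N : ℤ)) (N : ℤ), W m * polarCartesianCoeff s m α)
          atTop (𝓝 (kernelZ k β α))) ∧
    -- parabolic waves as integrals of Cartesian waves
    (∀ (s : WaveParity) (β ξ η : ℝ), 0 ≤ ξ →
      IntervalIntegrable
        (fun α : ℝ => kernelZ k β α * cartesianWave s k α ((ξ ^ 2 - η ^ 2) / 2) (ξ * η))
        volume 0 Real.pi ∧
      parabolicWave s k β ξ η =
        2 * ∫ α in (0 : ℝ)..Real.pi,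
          kernelZ k β α * cartesianWave s k α ((ξ ^ 2 - η ^ 2) / 2) (ξ * η)) ∧
    -- `∫ Z Z* dβ = δ(|α| - |α'|) / 2`, tested in `α` on `(-π, π)`
    (∀ α' : ℝ, 0 < |α'| → |α'| < Real.pi → ∀ f : ℝ → ℂ, ContDiff ℝ ∞ f →
      (∀ β : ℝ, IntervalIntegrable
        (fun α : ℝ => kernelZ k β α * conj (kernelZ k β α') * f α)
        volume (-Real.pi) Real.pi) ∧
      Integrable (fun β : ℝ =>
        ∫ α in (-Real.pi)..Real.pi, kernelZ k β α * conj (kernelZ k β α') * f α) ∧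
      (∫ β : ℝ, ∫ α in (-Real.pi)..Real.pi, kernelZ k β α * conj (kernelZ k β α') * f α) =
        (f α' + f (-α')) / 2) ∧
    -- `∫ Z Z* dα = δ(β - β')` over `(-π, π)`, tested in `β`
    (∀ (β' : ℝ) (f : 𝓢(ℝ, ℂ)),
      (∀ α : ℝ, 0 < |α| → |α| < Real.pi →
        Integrable (fun β : ℝ => kernelZ k β α * conj (kernelZ k β' α) * f β)) ∧
      IntervalIntegrable
        (fun α : ℝ => ∫ β : ℝ, kernelZ k β α * conj (kernelZ k β' α) * f β)
        volume (-Real.pi) Real.pi ∧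
      (∫ α in (-Real.pi)..Real.pi, ∫ β : ℝ, kernelZ k β α * conj (kernelZ k β' α) * f β) =
        f β') ∧
    -- the inverse expansion of Cartesian waves in parabolic waves
    (∀ (s : WaveParity) (α ξ η : ℝ), 0 < |α| → |α| < Real.pi → 0 ≤ ξ →
      Integrable (fun β : ℝ => conj (kernelZ k β α) * parabolicWave s k β ξ η) ∧
      cartesianWave s k α ((ξ ^ 2 - η ^ 2) / 2) (ξ * η) =
        ∫ β : ℝ, conj (kernelZ k β α) * parabolicWave s k β ξ η) := by
  refine ⟨fun s β => ?_, fun s β ξ η _ => ?_, fun α' h0 hp f hf => ?_, fun β' f => ?_,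
    fun s α ξ η h0 hp _ => ?_⟩
  · exact ⟨parabolicPolarCoeff s k β, isParabolicPolarExpansion_parabolicPolarCoeff s hk β,
      fun W' hW' => (isParabolicPolarExpansion_parabolicPolarCoeff s hk β).unique hk hW',
      fun α h0 hp => tendsto_sum_parabolicPolarCoeff_mul s hk β h0 hp⟩
  · exact ⟨intervalIntegrable_kernelZ_mul_cartesianWave s hk β _ _,
      parabolicWave_eq_integral s hk β ξ η⟩
  · exact kernelZ_completeness_angle hk h0 hp hf
  · exact kernelZ_completeness_parameter hk β' f
  · exact cartesianWave_eq_integral s hk ξ η h0 hp
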